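/- \textbf{Theorem (Cutoff).} For every $n\ge 1$ let $G_n=(V_n,E_n,(c_{xy})_{xy\in E_n})$ be a finite connected undirected weighted graph without loops, with $|V_n|=n$ and edge weights $c_{xy}=c_{yx}>0$, and let $\pi=\pi_n$ be a probability measure on $V_n$ with $\pi(x)>0$ for all $x\in V_n$ (the index $n$ is often omitted). \emph{The process.} For $k\in\mathbb N$ let $\Omega_k=\{\xi\in\mathbb N_0^{V}:\sum_{x}\xi(x)=k\}$. The Binomial Splitting process $\mathrm{Bin}(k)$ is the continuous-time Markov chain on $\Omega_k$ with generator $$\mathcal L^{\mathrm{Bin}(k)}f(\xi)=\sum_{xy\in E}c_{xy}\big(\mathbb E[f(\Xi^{xy}_\xi)]-f(\xi)\big),$$ where $\Xi^{xy}_\xi(x)=Y$, $\Xi^{xy}_\xi(y)=\xi(x)+\xi(y)-Y$, $\Xi^{xy}_\xi(z)=\xi(z)$ for $z\ne x,y$, and $Y\sim\mathrm{Binomial}\big(\xi(x)+\xi(y),\tfrac{\pi(x)}{\pi(x)+\pi(y)}\big)$. Its reversible law is the multinomial $\mu_{k,\pi}(\xi)=k!\prod_x \pi(x)^{\xi(x)}/\xi(x)!$.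 Put $$\mathbf d_k(t)=\max_{\xi\in\Omega_k}\big\|\delta_\xi e^{t\mathcal L^{\mathrm{Bin}(k)}}-\mu_{k,\pi}\big\|_{\mathrm{TV}},\qquad \|\mu-\nu\|_{\mathrm{TV}}=\max_{A\subseteq\Omega_k}|\mu(A)-\nu(A)|,$$ $$\mathrm{gap}=\inf_{f\ne0:\ \mathbb E_{\mu_{1,\pi}}[f]=0}\frac{\mathbb E_{\mu_{1,\pi}}[f(-\mathcal L^{\mathrm{Bin}(1)}f)]}{\mathbb E_{\mu_{1,\pi}}[f^2]},\qquad t_{\mathrm{rel}}=\mathrm{gap}^{-1},\qquad t_{\mathrm{mix}}=\frac{t_{\mathrm{rel}}}{2}\log k .$$ \emph{Assumptions.} With $\|\psi\|_p^p=\sum_x\pi(x)|\psi(x)|^p$ and $\mathcal E(\psi)=\sum_{xy\in E}c_{xy}\frac{\pi(x)\pi(y)}{\pi(x)+\pi(y)}(\psi(x)-\psi(y))^2$, suppose that there are positive numbers $d=d(n)$, $t_{\mathrm{Nash}}=t_{\mathrm{Nash}}(n)$, $T=T(n)$ such that, for all $n\ge 1$, $$\|\psi\|_2^{2(1+2/d)}\le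 t_{\mathrm{Nash}}\big(\mathcal E(\psi)+T^{-1}\|\psi\|_2^2\big)\|\psi\|_1^{4/d}\qquad\text{for all }\psi:V_n\to\mathbb R,$$ and such that, as $n\to\infty$, $d=O(1)$, $t_{\mathrm{Nash}}=O(t_{\mathrm{rel}})$ and $T=\Theta(t_{\mathrm{Nash}})$. Suppose also that there is $c_{\mathrm{ell}}\in[1,\infty)$ with $\max_{x}\pi(x)\le c_{\mathrm{ell}}\min_{y}\pi(y)$ for all $n\ge1$. Finally, let $k=k_n$ satisfy $k_n\to\infty$ and $k_n=O(n^2)$ as $n\to\infty$. \emph{Conclusion.} For every $\delta\in(0,1)$ there is $C=C(\delta)>0$ such that $$\limsup_{n\to\infty}\mathbf d_{k}(t_{\mathrm{mix}}+C\,t_{\mathrm{rel}})\le\delta\qquad\text{and}\qquad \liminf_{n\to\infty}\mathbf d_{k}(t_{\mathrm{mix}}-C\,t_{\mathrm{rel}})\ge1-\delta .$$ -/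

import Mathlib

open Filter Topology Asymptotics
open scoped BigOperators Nat Matrix

namespace BinomialSplitting

/-- `c` is the family of edge conductances of a connected, undirected weighted graph on `V`:
the edges are the pairs `xy` with `c x y > 0`, and there are no loops. -/
structure IsConductance {V : Type*} (c : V → V → ℝ) : Prop where
  symm : ∀ x y, c x y = c y x
  nonneg : ∀ x y, 0 ≤ c x y
  diag : ∀ x, c x x = 0
  connected : (SimpleGraph.fromRel fun x y => 0 < c x y).Connected

/-- `w` is a non-degenerate probability measure on `V`. -/
structure IsSiteWeight {V : Type*} [Fintype V] (w : V → ℝ) : Prop where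
  pos : ∀ x, 0 < w x
  sum_eq_one : ∑ x, w x = 1

/-- The configurations of `k` indistinguishable particles on the sites `V`. -/
abbrev Config (V : Type*) [Fintype V] (k : ℕ) : Type _ := {ξ : V → ℕ // ∑ x, ξ x = k}

noncomputable instance Config.instFintype (V : Type*) [Fintype V] [DecidableEq V] (k : ℕ) :
    Fintype (Config V k) :=
  Fintype.subtype (Finset.piAntidiag Finset.univ k) (by simp)

section Model

variable {V : Type*} [Fintype V] [DecidableEq V]

/-- The configuration obtained from `ξ` by putting `j` of the `ξ x + ξ y` particles sitting at `x`
or `y` on the site `x` and the remaining ones on the site `y`. -/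
def split (ξ : V → ℕ) (x y : V) (j : ℕ) : V → ℕ :=
  fun z => if z = x then j else if z = y then ξ x + ξ y - j else ξ z

/-- The transition matrix of the update along `xy`: row `ξ` is the law of `split ξ x y Y`, where
`Y ~ Binomial(ξ x + ξ y, w x / (w x + w y))`. -/
noncomputable def splitMatrix (w : V → ℝ) (k : ℕ) (x y : V) :
    Matrix (Config V k) (Config V k) ℝ :=
  Matrix.of fun ξ ζ =>
    ∑ j ∈ Finset.range (ξ.1 x + ξ.1 y + 1),
      ((ξ.1 x + ξ.1 y).choose j : ℝ) * (w x / (w x + w y)) ^ j *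
        (1 - w x / (w x + w y)) ^ (ξ.1 x + ξ.1 y - j) *
          (if ζ.1 = split ξ.1 x y j then 1 else 0)

/-- The generator of the Binomial Splitting process with `k` particles, as a matrix; the factor
`1 / 2` makes up for each edge being counted twice in the sum over ordered pairs. -/
noncomputable def generator (c : V → V → ℝ) (w : V → ℝ) (k : ℕ) :
    Matrix (Config V k) (Config V k) ℝ :=
  (1 / 2 : ℝ) • ∑ x, ∑ y, c x y • (splitMatrix w k x y - 1)

/-- The Markov semigroup `exp (t L)`, acting on functions from the left and on distributions
(row vectors) from the right. -/
noncomputable def semigroup (c : V → V → ℝ) (w : V → ℝ) (k : ℕ) (t : ℝ) :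
    Matrix (Config V k) (Config V k) ℝ :=
  NormedSpace.exp (t • generator c w k)

/-- The Multinomial distribution with parameters `(k, w)`. -/
noncomputable def multinomial (w : V → ℝ) (k : ℕ) (ξ : Config V k) : ℝ :=
  (k ! : ℝ) * ∏ x, w x ^ ξ.1 x / ((ξ.1 x)! : ℝ)

/-- The spectral gap of the `k`-particle process, through its Rayleigh quotient. -/
noncomputable def spectralGap (c : V → V → ℝ) (w : V → ℝ) (k : ℕ) : ℝ :=
  sInf {r : ℝ | ∃ f : Config V k → ℝ, f ≠ 0 ∧ ∑ ξ, multinomial w k ξ * f ξ = 0 ∧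
    r = (∑ ξ, multinomial w k ξ * (f ξ * (-(generator c w k *ᵥ f)) ξ)) /
      ∑ ξ, multinomial w k ξ * f ξ ^ 2}

/-- The relaxation time: the inverse of the spectral gap of the one-particle process. -/
noncomputable def relaxationTime (c : V → V → ℝ) (w : V → ℝ) : ℝ :=
  (spectralGap c w 1)⁻¹

/-- The norm of `L^p(V, w)`, for a finite exponent `p`. -/
noncomputable def siteNorm (w : V → ℝ) (p : ℝ) (ψ : V → ℝ) : ℝ :=
  (∑ x, w x * |ψ x| ^ p) ^ (1 / p)

/-- The Dirichlet form of the one-particle process, described through the particle's position. -/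
noncomputable def dirichletForm (c : V → V → ℝ) (w : V → ℝ) (ψ : V → ℝ) : ℝ :=
  (1 / 2 : ℝ) * ∑ x, ∑ y, c x y * (w x * w y / (w x + w y)) * (ψ x - ψ y) ^ 2

/-- The Nash inequality with constants `d`, `tNash`, `T` for the one-particle process. -/
def NashInequality (c : V → V → ℝ) (w : V → ℝ) (d tNash T : ℝ) : Prop :=
  ∀ ψ : V → ℝ,
    siteNorm w 2 ψ ^ (2 * (1 + 2 / d)) ≤
      tNash * (dirichletForm c w ψ + T⁻¹ * siteNorm w 2 ψ ^ 2) * siteNorm w 1 ψ ^ (4 / d)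

/-- Total variation distance between two mass functions on a finite set. -/
noncomputable def tvDist {Ω : Type*} (μ ν : Ω → ℝ) : ℝ :=
  ⨆ A : Finset Ω, |∑ ξ ∈ A, μ ξ - ∑ ξ ∈ A, ν ξ|

/-- Worst-case total variation distance to equilibrium of the `k`-particle process at time `t`. -/
noncomputable def worstTV (c : V → V → ℝ) (w : V → ℝ) (k : ℕ) (t : ℝ) : ℝ :=
  ⨆ ξ : Config V k, tvDist (Pi.single ξ 1 ᵥ* semigroup c w k t) (multinomial w k)

/-- The mixing time `t_mix = (t_rel / 2) log k`. -/
noncomputable def mixingTime (c : V → V → ℝ) (w : V → ℝ) (k : ℕ) : ℝ :=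
  relaxationTime c w / 2 * Real.log k

end Model

end BinomialSplitting

set_option linter.unusedSectionVars false

/-! Fix the sequence of edges that are updated. If labelled particles are independent with marginals
`η i`, an update keeps them independent and multiplies each marginal by the one-particle kernel
(`productLaw_vecMul_splitMatrix`). The law at time t is therefore a mixture of product laws, whose
random marginals follow the averaging process. This mixture is never constructed: by
`vecMul_exp_mem`, the semigroup keeps the pair (law, second moments of the marginals) inside every
closed convex set that contains an update-stable family. Inequalities that are convex in the law and
affine in the second moments define such sets.

Upper bound. For a product law the squared discrepancy from equilibrium is at most twice the sum of
the χ²-distances of the marginals. After averaging, this is the trace of the second moments minus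
one, for each particle. In an eigenbasis of the one-particle generator, the second moment of mode i
decays at rate 2λ_i but also receives noise from the updates. Summed over all modes the noise
cancels half of the dissipation, which alone would give only the rate gap instead of 2·gap. However,
modes with λ_i < 4·gap are uniformly bounded, so they receive only a fraction ε = O(1/n) of the
noise, while the remaining modes decay fast enough to absorb theirs. The resulting rate is (2 -
3ε)·gap (`two_scale_decay`, `modeMass_decay`). Since log k = o(n), the loss ε log k vanishes, and k
times the χ²-distance is small at t_mix + C t_rel.

The Nash inequality is used twice. Applied to the averaging process, it bounds the trace by a
constant at time T = O(t_rel) (`pairTrace_secondMoment_le`). As slow modes have lost only a constant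
factor by then, it also bounds the slow eigenfunctions (`sum_lowModes_sq_le`).

Lower bound. The particles start i.i.d. from equilibrium tilted along an eigenfunction for the gap,
and that eigenfunction, summed over the particles, is the test statistic. Its mean decays exactly at
rate gap, the correlation between particles is controlled by the same mode estimate, and Chebyshev's
inequality separates the two laws until t_mix - C t_rel (`le_worstTV`). -/

namespace BinomialSplitting

/-! ### Matrix exponentials of generators and invariance of closed convex sets. -/

section Exponential

/-- A closed convex set is stable under countable convex combinations. -/
theorem mem_of_hasSum_convex {E : Type*} [AddCommGroup E] [Module ℝ E] [TopologicalSpace E]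
    [ContinuousSMul ℝ E] {s : Set E} (hs : Convex ℝ s) (hc : IsClosed s) {p : ℕ → ℝ} {y : ℕ → E}
    {z : E} (hp : ∀ m, 0 ≤ p m) (hp1 : HasSum p 1) (hy : ∀ m, y m ∈ s)
    (hz : HasSum (fun m => p m • y m) z) : z ∈ s := by
  have h1 := hp1.tendsto_sum_nat
  have h2 := hz.tendsto_sum_nat
  have h3 : Tendsto (fun N => (∑ m ∈ Finset.range N, p m)⁻¹ • ∑ m ∈ Finset.range N, p m • y m)
      atTop (𝓝 z) := by
    simpa using (h1.inv₀ one_ne_zero).smul h2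
  refine hc.mem_of_tendsto h3 ?_
  filter_upwards [h1.eventually (lt_mem_nhds zero_lt_one)] with N hN
  exact hs.centerMass_mem (fun m _ => hp m) hN (fun m _ => hy m)

variable {ι κ ε : Type*} [Fintype ι] [DecidableEq ι] [Fintype κ] [DecidableEq κ] [Fintype ε]

open scoped Matrix.Norms.Operator in
theorem hasSum_exp_matrix (A : Matrix ι ι ℝ) :
    HasSum (fun n => ((n ! : ℝ)⁻¹) • A ^ n) (NormedSpace.exp A) :=
  NormedSpace.exp_series_hasSum_exp' A

open scoped Matrix.Norms.Operator in
theorem hasDerivAt_exp_smul_matrix (A : Matrix ι ι ℝ) (t : ℝ) :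
    HasDerivAt (fun u : ℝ => NormedSpace.exp (u • A)) (NormedSpace.exp (t • A) * A) t :=
  hasDerivAt_exp_smul_const A t

open scoped Matrix.Norms.Operator in
theorem hasDerivAt_vecMul_exp_dotProduct (v F : ι → ℝ) (A : Matrix ι ι ℝ) (t : ℝ) :
    HasDerivAt (fun u : ℝ => (v ᵥ* NormedSpace.exp (u • A)) ⬝ᵥ F)
      ((v ᵥ* NormedSpace.exp (t • A)) ⬝ᵥ (A *ᵥ F)) t := by
  let L : Matrix ι ι ℝ →ₗ[ℝ] ℝ :=
    { toFun := fun X => (v ᵥ* X) ⬝ᵥ F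
      map_add' := fun X Y => by rw [Matrix.vecMul_add, add_dotProduct]
      map_smul' := fun r X => by rw [Matrix.vecMul_smul, smul_dotProduct, RingHom.id_apply] }
  have h := (LinearMap.toContinuousLinearMap L).hasFDerivAt.comp_hasDerivAt t
    (hasDerivAt_exp_smul_matrix A t)
  have e : L (NormedSpace.exp (t • A) * A) = (v ᵥ* NormedSpace.exp (t • A)) ⬝ᵥ (A *ᵥ F) := by
    change (v ᵥ* (NormedSpace.exp (t • A) * A)) ⬝ᵥ F = _
    rw [← Matrix.vecMul_vecMul, Matrix.dotProduct_mulVec]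
  rw [← e]
  exact h

/-- Uniformization: the scalar part `-(t * ∑ e, c e)` of the exponent commutes with the rest and
factors out, leaving a power series with Poisson weights up to normalization by the total rate. -/
theorem hasSum_vecMul_exp (v : ι → ℝ) (c : ε → ℝ) (a : ε → Matrix ι ι ℝ) (t : ℝ) :
    HasSum (fun m : ℕ => (Real.exp (-(t * ∑ e, c e)) * (t ^ m / m !)) •
        (v ᵥ* (∑ e, c e • a e) ^ m))
      (v ᵥ* NormedSpace.exp (t • ∑ e, c e • (a e - 1))) := by
  set l := ∑ e, c e with hl
  set R := ∑ e, c e • a e with hR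
  have hgen : t • ∑ e, c e • (a e - 1) = (-(t * l)) • (1 : Matrix ι ι ℝ) + t • R := by
    simp only [smul_sub, Finset.sum_sub_distrib, ← Finset.sum_smul, ← hl, ← hR]
    rw [smul_smul, neg_smul]; abel
  have hone : NormedSpace.exp ((-(t * l)) • (1 : Matrix ι ι ℝ)) =
      Real.exp (-(t * l)) • (1 : Matrix ι ι ℝ) := by
    rw [← Matrix.diagonal_one, ← Matrix.diagonal_smul, Matrix.exp_diagonal, ← Matrix.diagonal_smul]
    congr 1
    ext i
    rw [Pi.coe_exp]
    simp [Real.exp_eq_exp_ℝ]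
  have hcomm : Commute ((-(t * l)) • (1 : Matrix ι ι ℝ)) (t • R) :=
    (Commute.one_left _).smul_left _
  rw [hgen, Matrix.exp_add_of_commute _ _ hcomm, hone, smul_mul_assoc, one_mul, Matrix.vecMul_smul]
  have h := hasSum_exp_matrix (t • R)
  let L : Matrix ι ι ℝ →+ (ι → ℝ) :=
    { toFun := fun X => v ᵥ* X
      map_add' := fun X Y => Matrix.vecMul_add X Y v
      map_zero' := Matrix.vecMul_zero v }
  have hL : Continuous L := Continuous.matrix_vecMul continuous_const continuous_id
  have h' := (h.map L hL).const_smul (Real.exp (-(t * l)))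
  convert! h' using 2 with m
  change _ = _ • (v ᵥ* ((m ! : ℝ)⁻¹ • (t • R) ^ m))
  rw [smul_pow, Matrix.vecMul_smul, Matrix.vecMul_smul, smul_smul, smul_smul]
  congr 1
  ring

/-- The exponential of a generator `∑ e, c e • (a e - 1)` maps a set of states which is stable under
all `a e` to its closed convex hull; this is formulated for two chains driven by the same updates. -/
theorem vecMul_exp_mem (c : ε → ℝ) (hc : ∀ e, 0 ≤ c e) (a : ε → Matrix ι ι ℝ)
    (b : ε → Matrix κ κ ℝ) {G D : Set ((ι → ℝ) × (κ → ℝ))}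
    (hG : ∀ e, c e ≠ 0 → ∀ z ∈ G, (z.1 ᵥ* a e, z.2 ᵥ* b e) ∈ G)
    (hGD : G ⊆ D) (hD : Convex ℝ D) (hDc : IsClosed D) {z : (ι → ℝ) × (κ → ℝ)} (hz : z ∈ G)
    {t : ℝ} (ht : 0 ≤ t) :
    (z.1 ᵥ* NormedSpace.exp (t • ∑ e, c e • (a e - 1)),
      z.2 ᵥ* NormedSpace.exp (t • ∑ e, c e • (b e - 1))) ∈ D := by
  set l := ∑ e, c e with hl
  have hl0 : 0 ≤ l := Finset.sum_nonneg fun e _ => hc e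
  have hstep : ∀ e, c e ≠ 0 → ∀ y ∈ convexHull ℝ G,
      (y.1 ᵥ* a e, y.2 ᵥ* b e) ∈ convexHull ℝ G := by
    intro e he
    let f : ((ι → ℝ) × (κ → ℝ)) →ₗ[ℝ] ((ι → ℝ) × (κ → ℝ)) :=
      (Matrix.vecMulLinear (a e)).prodMap (Matrix.vecMulLinear (b e))
    have : f '' convexHull ℝ G ⊆ convexHull ℝ G := by
      rw [f.image_convexHull]
      refine convexHull_mono ?_
      rintro _ ⟨y, hy, rfl⟩
      exact hG e he y hy
    intro y hy
    exact this ⟨y, hy, rfl⟩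
  -- One point `y` of the hull serves both chains at once; this is what couples them.
  have hpow : ∀ m : ℕ, ∃ y ∈ convexHull ℝ G,
      z.1 ᵥ* (∑ e, c e • a e) ^ m = l ^ m • y.1 ∧ z.2 ᵥ* (∑ e, c e • b e) ^ m = l ^ m • y.2 := by
    intro m
    induction m with
    | zero => exact ⟨z, subset_convexHull ℝ G hz, by simp, by simp⟩
    | succ m ih =>
      obtain ⟨y, hy, h1, h2⟩ := ih
      rcases hl0.eq_or_lt with h0 | h0
      · have hce : ∀ e, c e = 0 := fun e =>
          (Finset.sum_eq_zero_iff_of_nonneg (fun e _ => hc e)).1 h0.symm e (Finset.mem_univ e)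
        exact ⟨z, subset_convexHull ℝ G hz, by simp [hce, ← h0], by simp [hce, ← h0]⟩
      · refine ⟨∑ e, (c e / l) • (y.1 ᵥ* a e, y.2 ᵥ* b e), ?_, ?_, ?_⟩
        · have hw : ∑ e, c e / l = 1 := by rw [← Finset.sum_div, ← hl, div_self h0.ne']
          have := (convex_convexHull ℝ G).sum_mem (t := Finset.univ.filter fun e => c e ≠ 0)
            (w := fun e => c e / l) (z := fun e => (y.1 ᵥ* a e, y.2 ᵥ* b e))
            (fun e _ => div_nonneg (hc e) hl0) ?_
            (fun e he => hstep e (Finset.mem_filter.1 he).2 y hy)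
          · rwa [Finset.sum_filter_of_ne] at this
            intro e _ h h'
            simp [h'] at h
          · rw [Finset.sum_filter_of_ne, hw]
            intro e _ h h'
            simp [h'] at h
        · rw [pow_succ, ← Matrix.vecMul_vecMul, h1, Prod.fst_sum, Matrix.vecMul_sum, Finset.smul_sum]
          refine Finset.sum_congr rfl fun e _ => ?_
          rw [Matrix.smul_vecMul, Matrix.vecMul_smul, Prod.smul_fst, smul_smul, smul_smul, pow_succ]
          congr 1
          field_simp
        · rw [pow_succ, ← Matrix.vecMul_vecMul, h2, Prod.snd_sum, Matrix.vecMul_sum, Finset.smul_sum]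
          refine Finset.sum_congr rfl fun e _ => ?_
          rw [Matrix.smul_vecMul, Matrix.vecMul_smul, Prod.smul_snd, smul_smul, smul_smul, pow_succ]
          congr 1
          field_simp
  choose y hy h1 h2 using hpow
  have hyD : ∀ m, y m ∈ D := fun m => convexHull_min hGD hD (hy m)
  have hp1 : HasSum (fun m : ℕ => Real.exp (-(t * l)) * ((t * l) ^ m / m !)) 1 := by
    have := (NormedSpace.expSeries_div_hasSum_exp (t * l)).mul_left (Real.exp (-(t * l)))
    rwa [← Real.exp_eq_exp_ℝ, ← Real.exp_add, neg_add_cancel, Real.exp_zero] at this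
  refine mem_of_hasSum_convex hD hDc (fun m => ?_) hp1 hyD ?_
  · positivity
  · have e1 := hasSum_vecMul_exp z.1 c a t
    have e2 := hasSum_vecMul_exp z.2 c b t
    convert! e1.prodMk e2 using 2 with m
    rw [h1, h2, smul_smul, smul_smul, ← Prod.smul_mk]
    congr 1
    rw [mul_pow]; ring

end Exponential

/-! ### Grönwall-type differential inequalities. -/

section DifferentialInequalities

theorem le_initial_of_deriv_nonpos {f f' : ℝ → ℝ} (hf : ∀ t, 0 ≤ t → HasDerivAt f (f' t) t)
    (h : ∀ t, 0 ≤ t → f' t ≤ 0) {t : ℝ} (ht : 0 ≤ t) : f t ≤ f 0 := by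
  refine antitoneOn_of_deriv_nonpos (convex_Ici (0 : ℝ))
    (fun s hs => (hf s hs).continuousAt.continuousWithinAt) (fun s hs => ?_) (fun s hs => ?_)
    Set.self_mem_Ici ht ht
  · rw [interior_Ici] at hs
    exact (hf s (le_of_lt hs)).differentiableAt.differentiableWithinAt
  · rw [interior_Ici] at hs
    rw [(hf s (le_of_lt hs)).deriv]
    exact h s (le_of_lt hs)

theorem hasDerivAt_exp_const_mul (r t : ℝ) :
    HasDerivAt (fun s => Real.exp (r * s)) (Real.exp (r * t) * r) t := by
  simpa using ((hasDerivAt_id t).const_mul r).exp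

theorem le_exp_of_deriv_le {r : ℝ} {f f' : ℝ → ℝ} (hf : ∀ t, 0 ≤ t → HasDerivAt f (f' t) t)
    (h : ∀ t, 0 ≤ t → f' t ≤ -r * f t) {t : ℝ} (ht : 0 ≤ t) : f t ≤ Real.exp (-r * t) * f 0 := by
  have key := le_initial_of_deriv_nonpos (f := fun s => Real.exp (r * s) * f s)
    (fun s hs => (hasDerivAt_exp_const_mul r s).mul (hf s hs))
    (fun s hs => by
      have := mul_le_mul_of_nonneg_left (h s hs) (Real.exp_pos (r * s)).le
      linarith) ht
  simp only [mul_zero, Real.exp_zero, one_mul] at key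
  calc f t = Real.exp (-r * t) * (Real.exp (r * t) * f t) := by
        rw [← mul_assoc, ← Real.exp_add]; simp
    _ ≤ _ := mul_le_mul_of_nonneg_left key (Real.exp_pos _).le

theorem exp_le_of_le_deriv {r : ℝ} {f f' : ℝ → ℝ} (hf : ∀ t, 0 ≤ t → HasDerivAt f (f' t) t)
    (h : ∀ t, 0 ≤ t → -r * f t ≤ f' t) {t : ℝ} (ht : 0 ≤ t) : Real.exp (-r * t) * f 0 ≤ f t := by
  have := le_exp_of_deriv_le (r := r) (fun s hs => (hf s hs).neg)
    (fun s hs => by rw [Pi.neg_apply]; linarith [h s hs]) ht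
  simp only [Pi.neg_apply] at this
  linarith

theorem eq_exp_of_deriv_eq {r : ℝ} {f : ℝ → ℝ} (hf : ∀ t, 0 ≤ t → HasDerivAt f (-r * f t) t)
    {t : ℝ} (ht : 0 ≤ t) : f t = Real.exp (-r * t) * f 0 :=
  le_antisymm (le_exp_of_deriv_le hf (fun _ _ => le_rfl) ht)
    (exp_le_of_le_deriv hf (fun _ _ => le_rfl) ht)

/-- Decay of a slow mass `l` and a fast mass `h`, where the fast mass feeds the slow one with a
small rate only. -/
theorem two_scale_decay {θ ε : ℝ} (hθ : 0 < θ) (hε : 0 ≤ ε) (hε3 : ε ≤ 1 / 3)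
    {l l' h h' gl gh : ℝ → ℝ} (hl : ∀ t, 0 ≤ t → HasDerivAt l (l' t) t)
    (hh : ∀ t, 0 ≤ t → HasDerivAt h (h' t) t)
    (hl' : ∀ t, 0 ≤ t → l' t ≤ -2 * gl t + ε * (gl t + gh t))
    (hh' : ∀ t, 0 ≤ t → h' t ≤ gl t - gh t)
    (hgl : ∀ t, 0 ≤ t → θ * l t ≤ gl t) (hgl4 : ∀ t, 0 ≤ t → gl t ≤ 4 * θ * l t)
    (hgh : ∀ t, 0 ≤ t → 4 * θ * h t ≤ gh t) (hl0 : ∀ t, 0 ≤ t → 0 ≤ l t)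
    (hh0 : ∀ t, 0 ≤ t → 0 ≤ h t) {t : ℝ} (ht : 0 ≤ t) :
    l t ≤ Real.exp (-((2 - 3 * ε) * θ) * t) * (l 0 + 2 * ε * h 0) ∧
      l t + h t ≤ 4 * (l 0 + h 0) * Real.exp (-((2 - 3 * ε) * θ) * t) := by
  set ρ := 2 - 3 * ε with hρ
  have hρ1 : 1 ≤ ρ := by rw [hρ]; linarith
  have hρ2 : ρ ≤ 2 := by rw [hρ]; linarith
  set Φ0 := l 0 + 2 * ε * h 0 with hΦ0
  have h00 := hh0 0 le_rfl
  have hΦ0n : 0 ≤ Φ0 := add_nonneg (hl0 0 le_rfl) (by positivity)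
  -- The weight `2 * ε` turns the feed `ε * gh` of the slow mass into `-ε * gh`, which still yields
  -- decay of the fast part at rate `ρ * θ` because `gh ≥ 4 * θ * h` and `ρ ≤ 2`. The slow part pays
  -- `3 * ε` in the rate.
  have hA : ∀ s, 0 ≤ s → l s + 2 * ε * h s ≤ Real.exp (-(ρ * θ) * s) * Φ0 := by
    intro s hs
    refine le_exp_of_deriv_le (r := ρ * θ) (f := fun s => l s + 2 * ε * h s)
      (f' := fun s => l' s + 2 * ε * h' s)
      (fun u hu => (hl u hu).add ((hh u hu).const_mul _)) (fun u hu => ?_) hs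
    have e1 := hl' u hu
    have e2 := mul_le_mul_of_nonneg_left (hh' u hu) (by linarith : 0 ≤ 2 * ε)
    have e3 := mul_le_mul_of_nonneg_left (hgl u hu) (by linarith : 0 ≤ ρ)
    have e4 := mul_le_mul_of_nonneg_left (hgh u hu) hε
    have e5 : 2 * ε * ρ * (θ * h u) ≤ 4 * ε * (θ * h u) :=
      mul_le_mul_of_nonneg_right (by nlinarith) (mul_nonneg hθ.le (hh0 u hu))
    have e6 : ρ * gl u = 2 * gl u - 3 * ε * gl u := by rw [hρ]; ring
    show l' u + 2 * ε * h' u ≤ -(ρ * θ) * (l u + 2 * ε * h u)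
    linarith
  have hlt : ∀ s, 0 ≤ s → l s ≤ Real.exp (-(ρ * θ) * s) * Φ0 := fun s hs =>
    le_trans (le_add_of_nonneg_right (mul_nonneg (by linarith) (hh0 s hs))) (hA s hs)
  refine ⟨hlt t ht, ?_⟩
  -- With this `K`, `K * exp (-ρ θ t)` solves h' = 4θ(exp(-ρθt) Φ0 - h), the equation that dominates
  -- the fast mass once the bound on the slow one is inserted.
  set K := 4 * Φ0 / (4 - ρ) with hK
  have hKρ : K * (4 - ρ) = 4 * Φ0 := div_mul_cancel₀ _ (by linarith)
  have hK2 : K ≤ 2 * Φ0 := by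
    rw [hK, div_le_iff₀ (by linarith)]; nlinarith
  have hK0 : 0 ≤ K := div_nonneg (by linarith) (by linarith)
  have hB := le_initial_of_deriv_nonpos
    (f := fun s => Real.exp (4 * θ * s) * h s - K * Real.exp ((4 - ρ) * θ * s))
    (fun s hs => ((hasDerivAt_exp_const_mul (4 * θ) s).mul (hh s hs)).sub
      ((hasDerivAt_exp_const_mul ((4 - ρ) * θ) s).const_mul K))
    (fun s hs => by
      have e1 : h' s ≤ 4 * θ * (Real.exp (-(ρ * θ) * s) * Φ0) - 4 * θ * h s := by
        have := mul_le_mul_of_nonneg_left (hlt s hs) (by linarith : 0 ≤ 4 * θ)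
        linarith [hh' s hs, hgl4 s hs, hgh s hs]
      have e2 := mul_le_mul_of_nonneg_left e1 (Real.exp_pos (4 * θ * s)).le
      have e3 : Real.exp ((4 - ρ) * θ * s) = Real.exp (4 * θ * s) * Real.exp (-(ρ * θ) * s) := by
        rw [← Real.exp_add]; congr 1; ring
      rw [e3]
      have e4 : K * (Real.exp (4 * θ * s) * Real.exp (-(ρ * θ) * s) * ((4 - ρ) * θ)) =
          4 * Φ0 * (Real.exp (4 * θ * s) * Real.exp (-(ρ * θ) * s) * θ) := by
        rw [← hKρ]; ring
      rw [e4]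
      linarith) ht
  simp only [mul_zero, Real.exp_zero, one_mul, mul_one] at hB
  have hC : h t ≤ Real.exp (-(4 * θ) * t) * h 0 + K * Real.exp (-(ρ * θ) * t) := by
    have e1 : Real.exp (4 * θ * t) * h t ≤ h 0 + K * Real.exp ((4 - ρ) * θ * t) := by linarith
    have e2 := mul_le_mul_of_nonneg_left e1 (Real.exp_pos (-(4 * θ) * t)).le
    have e3 : Real.exp (-(4 * θ) * t) * Real.exp (4 * θ * t) = 1 := by
      rw [← Real.exp_add]; simp
    have e4 : Real.exp (-(4 * θ) * t) * Real.exp ((4 - ρ) * θ * t) = Real.exp (-(ρ * θ) * t) := by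
      rw [← Real.exp_add]; congr 1; ring
    calc h t = Real.exp (-(4 * θ) * t) * Real.exp (4 * θ * t) * h t := by rw [e3, one_mul]
      _ = Real.exp (-(4 * θ) * t) * (Real.exp (4 * θ * t) * h t) := by ring
      _ ≤ _ := e2
      _ = Real.exp (-(4 * θ) * t) * h 0 +
          K * (Real.exp (-(4 * θ) * t) * Real.exp ((4 - ρ) * θ * t)) := by ring
      _ = _ := by rw [e4]
  have hD : Real.exp (-(4 * θ) * t) ≤ Real.exp (-(ρ * θ) * t) := by
    apply Real.exp_le_exp.2
    have : ρ * (θ * t) ≤ 4 * (θ * t) :=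
      mul_le_mul_of_nonneg_right (by linarith) (mul_nonneg hθ.le ht)
    linarith
  have hE := mul_le_mul_of_nonneg_right hD h00
  have hF : Φ0 ≤ l 0 + h 0 := by
    rw [hΦ0]
    have : 2 * ε * h 0 ≤ 1 * h 0 := mul_le_mul_of_nonneg_right (by linarith) h00
    linarith
  have hexp := Real.exp_pos (-(ρ * θ) * t)
  have h6 := mul_le_mul_of_nonneg_right hK2 hexp.le
  have h7 := mul_le_mul_of_nonneg_right hF hexp.le
  have h8 := mul_nonneg (hl0 0 le_rfl) hexp.le
  have := hlt t ht
  linarith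

/-- The bound at time `T` which the differential form of a Nash inequality gives. -/
theorem nash_differential_bound {p tN T K : ℝ} (hp : 0 < p) (hN : 0 < tN) (hT : 0 < T)
    (hK : tN ≤ K * T) {F F' : ℝ → ℝ} (hF : ∀ t, 0 ≤ t → HasDerivAt F (F' t) t)
    (hF1 : ∀ t, 0 ≤ t → 1 ≤ F t) (h : ∀ t, 0 ≤ t → F' t ≤ F t / T - F t ^ (1 + p) / tN) :
    F T ≤ (K * Real.exp p / (Real.exp p - 1)) ^ (1 / p) := by
  have hpos : ∀ t, 0 ≤ t → 0 < F t := fun t ht => lt_of_lt_of_le one_pos (hF1 t ht)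
  -- Bernoulli substitution: `F ^ (-p)` satisfies a linear differential inequality with fixed point
  -- `T / tN` and rate `p / T`, whatever the initial value of `F`.
  have key := le_initial_of_deriv_nonpos
    (f := fun s => Real.exp (p / T * s) * (T / tN - F s ^ (-p)))
    (fun s hs => (hasDerivAt_exp_const_mul (p / T) s).mul
      (((hF s hs).rpow_const (p := -p) (Or.inl (hpos s hs).ne')).const_sub (T / tN)))
    (fun s hs => by
      have hFs := hpos s hs
      have e0 : F s ^ (1 + p) * F s ^ (-p - 1) = 1 := by
        rw [← Real.rpow_add hFs, show (1 + p) + (-p - 1) = 0 by ring, Real.rpow_zero]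
      have e1 : F s * F s ^ (-p - 1) = F s ^ (-p) := by
        nth_rewrite 1 [← Real.rpow_one (F s)]
        rw [← Real.rpow_add hFs]; congr 1; ring
      have e2 := mul_le_mul_of_nonneg_right (h s hs)
        (mul_nonneg hp.le (Real.rpow_nonneg hFs.le (-p - 1)))
      have e3 : (F s / T - F s ^ (1 + p) / tN) * (p * F s ^ (-p - 1)) =
          p / T * F s ^ (-p) - p / tN := by
        rw [← e1]
        calc _ = p / T * (F s * F s ^ (-p - 1)) - p / tN * (F s ^ (1 + p) * F s ^ (-p - 1)) := by
              ring
          _ = _ := by rw [e0, mul_one]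
      rw [e3] at e2
      have e4 : p / T * (T / tN) = p / tN := by field_simp
      have e5 : Real.exp (p / T * s) * (p / T * (T / tN - F s ^ (-p)) +
          F' s * (p * F s ^ (-p - 1))) ≤ 0 :=
        mul_nonpos_of_nonneg_of_nonpos (Real.exp_pos _).le (by rw [mul_sub, e4]; linarith)
      linarith) hT.le
  simp only [mul_zero, Real.exp_zero, one_mul, div_mul_cancel₀ _ hT.ne'] at key
  have hFT := hpos T hT.le
  have h0 : 0 < F 0 ^ (-p) := Real.rpow_pos_of_pos (hpos 0 le_rfl) _
  have hep : 0 < Real.exp p - 1 := by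
    have := Real.add_one_lt_exp hp.ne'; linarith
  have h1 : T / tN * (Real.exp p - 1) ≤ Real.exp p * F T ^ (-p) := by linarith
  have hK0 : 0 < K := by
    by_contra hc
    exact absurd hN (not_lt.2 (hK.trans (mul_nonpos_of_nonpos_of_nonneg (not_lt.1 hc) hT.le)))
  have h2 : F T ^ p ≤ K * Real.exp p / (Real.exp p - 1) := by
    rw [Real.rpow_neg hFT.le, ← div_eq_mul_inv, le_div_iff₀ (Real.rpow_pos_of_pos hFT _)] at h1
    rw [le_div_iff₀ hep]
    have h3 : 1 ≤ K * (T / tN) := by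
      rw [mul_div_assoc', le_div_iff₀ hN]; linarith
    have h4 := mul_le_mul_of_nonneg_left h1 hK0.le
    have h5 := mul_le_mul_of_nonneg_right h3
      (mul_nonneg hep.le (Real.rpow_pos_of_pos hFT p).le)
    linarith
  calc F T = (F T ^ p) ^ (1 / p) := by
        rw [← Real.rpow_mul hFT.le, mul_one_div_cancel hp.ne', Real.rpow_one]
    _ ≤ _ := Real.rpow_le_rpow (Real.rpow_nonneg hFT.le _) h2 (by positivity)

end DifferentialInequalities

/-! ### The one-particle update along an edge. -/

section EdgeKernel

variable {V : Type*} [Fintype V] [DecidableEq V]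

/-- The direction in which an update along `xy` changes functions on the sites. -/
noncomputable def edgeVec (w : V → ℝ) (x y : V) : V → ℝ :=
  (w x + w y)⁻¹ • (Pi.single x (w y) - Pi.single y (w x))

/-- The one-particle transition matrix of an update along `xy`. -/
noncomputable def edgeKernel (w : V → ℝ) (x y : V) : Matrix V V ℝ :=
  1 - Matrix.vecMulVec (edgeVec w x y) (Pi.single x 1 - Pi.single y 1)

/-- Probability vectors on the sites. -/
structure IsProbVec (η : V → ℝ) : Prop where
  nonneg : ∀ v, 0 ≤ η v
  sum_eq_one : ∑ v, η v = 1

theorem IsSiteWeight.isProbVec {w : V → ℝ} (hw : IsSiteWeight w) : IsProbVec w :=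
  ⟨fun v => (hw.pos v).le, hw.sum_eq_one⟩

theorem IsProbVec.single (x : V) : IsProbVec (Pi.single x (1 : ℝ) : V → ℝ) :=
  ⟨fun v => by by_cases h : v = x <;> simp [h], by simp [Pi.single_apply]⟩

theorem edgeKernel_mulVec (w : V → ℝ) (x y : V) (a : V → ℝ) :
    edgeKernel w x y *ᵥ a = a - (a x - a y) • edgeVec w x y := by
  rw [edgeKernel, Matrix.sub_mulVec, Matrix.one_mulVec, Matrix.vecMulVec_mulVec, sub_dotProduct,
    single_one_dotProduct, single_one_dotProduct]
  ext v
  simp [mul_comm]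

theorem vecMul_edgeKernel (w : V → ℝ) (x y : V) (η : V → ℝ) :
    η ᵥ* edgeKernel w x y =
      η - (η ⬝ᵥ edgeVec w x y) • (Pi.single x (1 : ℝ) - Pi.single y 1 : V → ℝ) := by
  rw [edgeKernel, Matrix.vecMul_sub, Matrix.vecMul_one, Matrix.vecMul_vecMulVec]

theorem dotProduct_edgeVec (w : V → ℝ) (x y : V) (a : V → ℝ) :
    a ⬝ᵥ edgeVec w x y = (a x * w y - a y * w x) / (w x + w y) := by
  rw [edgeVec, dotProduct_smul, dotProduct_sub, dotProduct_single, dotProduct_single, smul_eq_mul]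
  ring

theorem edgeKernel_mulVec_apply_left {w : V → ℝ} (hw : ∀ v, 0 < w v) {x y : V} (hxy : x ≠ y)
    (z : V → ℝ) : (edgeKernel w x y *ᵥ z) x =
      w x / (w x + w y) * z x + (1 - w x / (w x + w y)) * z y := by
  have := hw x; have := hw y
  rw [edgeKernel_mulVec]
  simp [edgeVec, hxy]
  field_simp
  ring

theorem edgeKernel_mulVec_apply_right {w : V → ℝ} (hw : ∀ v, 0 < w v) {x y : V} (hxy : x ≠ y)
    (z : V → ℝ) : (edgeKernel w x y *ᵥ z) y =
      w x / (w x + w y) * z x + (1 - w x / (w x + w y)) * z y := by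
  have := hw x; have := hw y
  rw [edgeKernel_mulVec]
  simp [edgeVec, Ne.symm hxy]
  field_simp
  ring

theorem edgeKernel_mulVec_apply_of_ne (w : V → ℝ) {x y v : V} (hx : v ≠ x) (hy : v ≠ y)
    (z : V → ℝ) : (edgeKernel w x y *ᵥ z) v = z v := by
  rw [edgeKernel_mulVec]
  simp [edgeVec, hx, hy]

theorem edgeKernel_mulVec_one (w : V → ℝ) (x y : V) : edgeKernel w x y *ᵥ 1 = 1 := by
  rw [edgeKernel_mulVec]; simp

theorem IsProbVec.vecMul_edgeKernel {w : V → ℝ} (hw : ∀ v, 0 < w v) {η : V → ℝ}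
    (hη : IsProbVec η) (x y : V) : IsProbVec (η ᵥ* edgeKernel w x y) := by
  constructor
  · intro v
    rcases eq_or_ne x y with rfl | hxy
    · rw [BinomialSplitting.vecMul_edgeKernel]; simpa using hη.nonneg v
    have h1 := hw x; have h2 := hw y; have h3 := hη.nonneg x; have h4 := hη.nonneg y
    have h5 : 0 < w x + w y := add_pos h1 h2
    rw [BinomialSplitting.vecMul_edgeKernel, dotProduct_edgeVec]
    by_cases hx : v = x
    · subst hx
      have : (η - ((η v * w y - η y * w v) / (w v + w y)) •
          (Pi.single v (1 : ℝ) - Pi.single y 1 : V → ℝ)) v = (η v + η y) * w v / (w v + w y) := by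
        simp [hxy]; field_simp; ring
      rw [this]; positivity
    by_cases hy : v = y
    · subst hy
      have : (η - ((η x * w v - η v * w x) / (w x + w v)) •
          (Pi.single x (1 : ℝ) - Pi.single v 1 : V → ℝ)) v = (η x + η v) * w v / (w x + w v) := by
        simp [Ne.symm hxy]; field_simp; ring
      rw [this]; positivity
    · simpa [hx, hy] using hη.nonneg v
  · have := Matrix.dotProduct_mulVec η (edgeKernel w x y) 1
    rw [edgeKernel_mulVec_one, dotProduct_one, dotProduct_one, hη.sum_eq_one] at this
    exact this.symm

end EdgeKernel

/-! ### Generating functions of laws on configurations. -/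

section GeneratingFunctions

variable {V : Type*} [Fintype V] [DecidableEq V] {k : ℕ}

/-- The multivariate generating function of a mass function on configurations. -/
noncomputable def genFun (p : Config V k → ℝ) (z : V → ℝ) : ℝ :=
  ∑ ζ, p ζ * ∏ v, z v ^ ζ.1 v

/-- Polynomials over an infinite field are determined by their values, and distinct configurations
have distinct monomials. -/
theorem genFun_injective : Function.Injective (genFun : (Config V k → ℝ) → (V → ℝ) → ℝ) := by
  let P : (Config V k → ℝ) → MvPolynomial V ℝ := fun p =>
    ∑ ζ : Config V k, MvPolynomial.monomial (Finsupp.equivFunOnFinite.symm ζ.1) (p ζ)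
  have hP : ∀ p z, MvPolynomial.eval z (P p) = genFun p z := by
    intro p z
    simp only [P, map_sum, MvPolynomial.eval_monomial, genFun]
    refine Finset.sum_congr rfl fun ζ _ => ?_
    rw [Finsupp.prod_fintype _ _ (fun _ => pow_zero _)]
    rfl
  have hc : ∀ p (ζ : Config V k),
      MvPolynomial.coeff (Finsupp.equivFunOnFinite.symm ζ.1) (P p) = p ζ := by
    intro p ζ
    simp only [P, MvPolynomial.coeff_sum, MvPolynomial.coeff_monomial]
    rw [Finset.sum_eq_single ζ]
    · simp
    · intro b _ hb
      rw [if_neg]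
      intro h
      exact hb (Subtype.ext (Finsupp.equivFunOnFinite.symm.injective h))
    · simp
  intro p q hpq
  have : P p = P q := MvPolynomial.funext fun z => by rw [hP, hP, hpq]
  funext ζ
  rw [← hc p, ← hc q, this]

theorem prod_eq_mul_mul_prod_erase {M : Type*} [CommMonoid M] {x y : V} (hxy : x ≠ y) (f : V → M) :
    ∏ v, f v = f x * f y * ∏ v ∈ (Finset.univ.erase x).erase y, f v := by
  rw [← Finset.mul_prod_erase Finset.univ f (Finset.mem_univ x),
    ← Finset.mul_prod_erase (Finset.univ.erase x) f
      (Finset.mem_erase.2 ⟨hxy.symm, Finset.mem_univ y⟩), mul_assoc]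

theorem sum_split {x y : V} (hxy : x ≠ y) (ξ : Config V k) {j : ℕ} (hj : j ≤ ξ.1 x + ξ.1 y) :
    ∑ v, split ξ.1 x y j v = k := by
  have h1 := ξ.2
  -- `Multiplicative` lets the splitting of products serve for the sum of particle numbers.
  have e1 := prod_eq_mul_mul_prod_erase hxy (fun v => Multiplicative.ofAdd (ξ.1 v))
  have e2 := prod_eq_mul_mul_prod_erase hxy (fun v => Multiplicative.ofAdd (split ξ.1 x y j v))
  have e3 : ∏ v ∈ (Finset.univ.erase x).erase y, Multiplicative.ofAdd (split ξ.1 x y j v) =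
      ∏ v ∈ (Finset.univ.erase x).erase y, Multiplicative.ofAdd (ξ.1 v) :=
    Finset.prod_congr rfl fun v hv => by
      simp only [Finset.mem_erase] at hv
      simp [split, hv.1, hv.2.1]
  have e4 : Multiplicative.ofAdd (split ξ.1 x y j x) * Multiplicative.ofAdd (split ξ.1 x y j y) =
      Multiplicative.ofAdd (ξ.1 x) * Multiplicative.ofAdd (ξ.1 y) := by
    rw [← ofAdd_add, ← ofAdd_add]
    congr 1
    simp only [split, if_true, if_neg hxy.symm]
    omega
  rw [e3, e4, ← e1, ← ofAdd_sum, ← ofAdd_sum, h1] at e2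
  exact Multiplicative.ofAdd.injective e2

/-- The binomial theorem: summing over the split replaces both `z x` and `z y` by their weighted
average, raised to the powers `ξ x` and `ξ y`. -/
theorem genFun_splitMatrix_row {w : V → ℝ} (hw : ∀ v, 0 < w v) {x y : V} (hxy : x ≠ y)
    (ξ : Config V k) (z : V → ℝ) :
    genFun (splitMatrix w k x y ξ) z = ∏ v, (edgeKernel w x y *ᵥ z) v ^ ξ.1 v := by
  set p := w x / (w x + w y) with hp
  set m := ξ.1 x + ξ.1 y with hm
  have h1 : genFun (splitMatrix w k x y ξ) z =
      ∑ j ∈ Finset.range (m + 1), (m.choose j : ℝ) * p ^ j * (1 - p) ^ (m - j) *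
        ∏ v, z v ^ split ξ.1 x y j v := by
    simp only [genFun, splitMatrix, Matrix.of_apply, Finset.sum_mul]
    rw [Finset.sum_comm]
    refine Finset.sum_congr rfl fun j hj => ?_
    have hj' : j ≤ m := Nat.lt_succ_iff.1 (Finset.mem_range.1 hj)
    rw [Finset.sum_eq_single (⟨split ξ.1 x y j, sum_split hxy ξ hj'⟩ : Config V k)]
    · simp only [if_true, mul_one, hp, hm]
    · intro ζ _ hζ
      rw [if_neg (fun h => hζ (Subtype.ext h))]
      simp
    · simp
  rw [h1, prod_eq_mul_mul_prod_erase hxy, edgeKernel_mulVec_apply_left hw hxy,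
    edgeKernel_mulVec_apply_right hw hxy, ← pow_add, ← hp, ← hm, add_pow, Finset.sum_mul]
  refine Finset.sum_congr rfl fun j hj => ?_
  rw [prod_eq_mul_mul_prod_erase hxy]
  have e : ∏ v ∈ (Finset.univ.erase x).erase y, z v ^ split ξ.1 x y j v =
      ∏ v ∈ (Finset.univ.erase x).erase y, (edgeKernel w x y *ᵥ z) v ^ ξ.1 v :=
    Finset.prod_congr rfl fun v hv => by
      simp only [Finset.mem_erase] at hv
      rw [edgeKernel_mulVec_apply_of_ne w hv.2.1 hv.1]
      simp [split, hv.1, hv.2.1]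
  rw [e]
  simp only [split, if_true, if_neg hxy.symm, ← hm, mul_pow]
  ring

theorem genFun_vecMul_splitMatrix {w : V → ℝ} (hw : ∀ v, 0 < w v) {x y : V} (hxy : x ≠ y)
    (p : Config V k → ℝ) (z : V → ℝ) :
    genFun (p ᵥ* splitMatrix w k x y) z = genFun p (edgeKernel w x y *ᵥ z) := by
  simp only [genFun, Matrix.vecMul, dotProduct, Finset.sum_mul]
  rw [Finset.sum_comm]
  refine Finset.sum_congr rfl fun ξ _ => ?_
  rw [← genFun_splitMatrix_row hw hxy ξ z, genFun, Finset.mul_sum]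
  exact Finset.sum_congr rfl fun ζ _ => by ring

end GeneratingFunctions

/-! ### Configurations of independent labelled particles. -/

section ProductLaw

variable {V ι : Type*} [Fintype V] [DecidableEq V] [Fintype ι] [DecidableEq ι] {k : ℕ}

/-- The configuration of the labelled particles at the positions `x`. -/
def countConfig (hι : Fintype.card ι = k) (x : ι → V) : Config V k :=
  ⟨fun v => (Finset.univ.filter fun i => x i = v).card, by
    rw [← hι, ← Finset.card_univ, Finset.card_eq_sum_card_fiberwise (f := x) (t := Finset.univ)]
    intro _ _; exact Finset.mem_coe.2 (Finset.mem_univ _)⟩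

/-- The law of the configuration of independent particles with marginals `η i`. -/
noncomputable def productLaw (hι : Fintype.card ι = k) (η : ι → V → ℝ) (ζ : Config V k) : ℝ :=
  ∑ x : ι → V, if countConfig hι x = ζ then ∏ i, η i (x i) else 0

theorem sum_productLaw_mul (hι : Fintype.card ι = k) (η : ι → V → ℝ) (f : Config V k → ℝ) :
    ∑ ζ, productLaw hι η ζ * f ζ = ∑ x : ι → V, (∏ i, η i (x i)) * f (countConfig hι x) := by
  simp only [productLaw, Finset.sum_mul]
  rw [Finset.sum_comm]
  refine Finset.sum_congr rfl fun x _ => ?_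
  rw [Finset.sum_eq_single (countConfig hι x)]
  · simp
  · intro ζ _ hζ
    rw [if_neg hζ.symm, zero_mul]
  · simp

theorem sum_pi_prod (f : ι → V → ℝ) : ∑ x : ι → V, ∏ i, f i (x i) = ∏ i, ∑ v, f i v := by
  rw [Finset.prod_univ_sum, Fintype.piFinset_univ]

theorem prod_pow_countConfig (hι : Fintype.card ι = k) (x : ι → V) (z : V → ℝ) :
    ∏ v, z v ^ (countConfig hι x).1 v = ∏ i, z (x i) := by
  rw [← Finset.prod_fiberwise_of_maps_to (g := x) (t := Finset.univ) (fun _ _ => Finset.mem_univ _)]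
  refine Finset.prod_congr rfl fun v _ => ?_
  rw [Finset.prod_congr rfl (g := fun _ => z v)
    (fun i hi => by rw [(Finset.mem_filter.1 hi).2]), Finset.prod_const]
  rfl

theorem genFun_productLaw (hι : Fintype.card ι = k) (η : ι → V → ℝ) (z : V → ℝ) :
    genFun (productLaw hι η) z = ∏ i, η i ⬝ᵥ z := by
  rw [genFun, sum_productLaw_mul hι η fun ζ => ∏ v, z v ^ ζ.1 v]
  simp only [prod_pow_countConfig, ← Finset.prod_mul_distrib]
  rw [sum_pi_prod (fun i v => η i v * z v)]
  rfl

/-- The structural fact behind the whole argument. The generating function of independent particles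
is a product of linear forms in `z`, and an update substitutes `z` linearly, hence acts on each
factor separately. -/
theorem productLaw_vecMul_splitMatrix (hι : Fintype.card ι = k) {w : V → ℝ} (hw : ∀ v, 0 < w v)
    {x y : V} (hxy : x ≠ y) (η : ι → V → ℝ) :
    productLaw hι η ᵥ* splitMatrix w k x y = productLaw hι fun i => η i ᵥ* edgeKernel w x y := by
  refine genFun_injective (funext fun z => ?_)
  rw [genFun_vecMul_splitMatrix hw hxy, genFun_productLaw, genFun_productLaw]
  exact Finset.prod_congr rfl fun i _ => Matrix.dotProduct_mulVec _ _ _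

theorem multinomial_eq_productLaw (hι : Fintype.card ι = k) (w : V → ℝ) :
    multinomial w k = productLaw hι fun _ => w := by
  refine genFun_injective (funext fun z => ?_)
  rw [genFun_productLaw, Finset.prod_const, Finset.card_univ, hι, dotProduct,
    Finset.sum_pow_eq_sum_piAntidiag, genFun]
  symm
  refine Finset.sum_bij' (fun a ha => (⟨a, by simpa using ha⟩ : Config V k)) (fun ζ _ => ζ.1)
    (fun _ _ => Finset.mem_univ _) (fun ζ _ => by simpa using ζ.2) (fun _ _ => rfl)
    (fun _ _ => rfl) (fun a ha => ?_)
  have hk : ∑ v, a v = k := by simpa using ha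
  have h1 : ((Nat.multinomial Finset.univ a : ℕ) : ℝ) = (k ! : ℝ) / ∏ v, ((a v)! : ℝ) := by
    rw [eq_div_iff (Finset.prod_ne_zero_iff.2 fun v _ => by positivity), mul_comm]
    have := Nat.multinomial_spec Finset.univ a
    rw [hk] at this
    exact_mod_cast this
  simp only [multinomial]
  rw [h1, Finset.prod_div_distrib]
  simp only [mul_pow, Finset.prod_mul_distrib]
  ring

theorem productLaw_single (hι : Fintype.card ι = k) (x : ι → V) :
    productLaw hι (fun i => Pi.single (x i) 1) = Pi.single (countConfig hι x) 1 := by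
  refine genFun_injective (funext fun z => ?_)
  rw [genFun_productLaw, genFun, Finset.sum_eq_single (countConfig hι x)]
  · simp [prod_pow_countConfig]
  · intro ζ _ hζ; simp [hζ]
  · simp

/-- Labels the particles of a deterministic start, so that its law is a product of point masses. -/
theorem exists_countConfig_eq (ξ : Config V k) :
    ∃ (hι : Fintype.card (Σ v, Fin (ξ.1 v)) = k), countConfig hι (fun i => i.1) = ξ := by
  refine ⟨by simp [ξ.2], Subtype.ext (funext fun v => ?_)⟩
  simp only [countConfig]
  rw [Finset.card_filter, Fintype.sum_sigma, Finset.sum_eq_single v]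
  · simp
  · intro u _ hu; simp [hu]
  · simp

theorem productLaw_nonneg (hι : Fintype.card ι = k) {η : ι → V → ℝ} (hη : ∀ i, IsProbVec (η i))
    (ζ : Config V k) : 0 ≤ productLaw hι η ζ :=
  Finset.sum_nonneg fun x _ => by
    split_ifs
    · exact Finset.prod_nonneg fun i _ => (hη i).nonneg _
    · exact le_rfl

theorem sum_productLaw (hι : Fintype.card ι = k) {η : ι → V → ℝ} (hη : ∀ i, IsProbVec (η i)) :
    ∑ ζ, productLaw hι η ζ = 1 := by
  have := sum_productLaw_mul hι η fun _ => 1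
  simp only [mul_one] at this
  rw [this, sum_pi_prod]
  exact Finset.prod_eq_one fun i _ => (hη i).sum_eq_one

end ProductLaw

/-! ### Total variation and the second moment method. -/

section TotalVariation

theorem abs_sub_le_tvDist {Ω : Type*} [Fintype Ω] (μ ν : Ω → ℝ) (A : Finset Ω) :
    |∑ ξ ∈ A, μ ξ - ∑ ξ ∈ A, ν ξ| ≤ tvDist μ ν :=
  le_ciSup (f := fun A : Finset Ω => |∑ ξ ∈ A, μ ξ - ∑ ξ ∈ A, ν ξ|) (Set.finite_range _).bddAbove A

theorem tvDist_nonneg {Ω : Type*} [Fintype Ω] (μ ν : Ω → ℝ) : 0 ≤ tvDist μ ν := by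
  simpa using abs_sub_le_tvDist μ ν ∅

/-- The second moment method, for a statistic which is centred under the second law. -/
theorem exists_finset_one_sub_le {Ω : Type*} [Fintype Ω] {p q : Ω → ℝ} (hp : ∀ ω, 0 ≤ p ω)
    (hp1 : ∑ ω, p ω = 1) (hq : ∀ ω, 0 ≤ q ω) (Φ : Ω → ℝ) {m : ℝ} (hm : 0 < m)
    (hΦ : ∑ ω, p ω * Φ ω = m) :
    ∃ A : Finset Ω, 1 - 4 * (∑ ω, p ω * Φ ω ^ 2 - m ^ 2) / m ^ 2 -
      4 * (∑ ω, q ω * Φ ω ^ 2) / m ^ 2 ≤ ∑ ω ∈ A, p ω - ∑ ω ∈ A, q ω := by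
  classical
  -- The threshold `m / 2` is at distance `m / 2` from both `m` and `0`, so Chebyshev's inequality
  -- costs a factor `4 / m ^ 2` under either law.
  refine ⟨Finset.univ.filter fun ω => m / 2 < Φ ω, ?_⟩
  have hm2 : 0 < m ^ 2 := by positivity
  have h1 : 1 - 4 * (∑ ω, p ω * Φ ω ^ 2 - m ^ 2) / m ^ 2 ≤
      ∑ ω ∈ Finset.univ.filter (fun ω => m / 2 < Φ ω), p ω := by
    have e : 1 - 4 * (∑ ω, p ω * Φ ω ^ 2 - m ^ 2) / m ^ 2 =
        ∑ ω, p ω * (1 - 4 * (Φ ω - m) ^ 2 / m ^ 2) := by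
      have e1 : ∀ ω, p ω * (1 - 4 * (Φ ω - m) ^ 2 / m ^ 2) =
          p ω - 4 / m ^ 2 * (p ω * Φ ω ^ 2) + 8 / m * (p ω * Φ ω) - 4 * p ω := by
        intro ω; field_simp; ring
      simp only [e1, Finset.sum_sub_distrib, Finset.sum_add_distrib, ← Finset.mul_sum]
      rw [hp1, hΦ]; field_simp; ring
    rw [e, Finset.sum_filter]
    refine Finset.sum_le_sum fun ω _ => ?_
    have h0 : 0 ≤ 4 * (Φ ω - m) ^ 2 / m ^ 2 := by positivity
    split_ifs with h
    · nlinarith [hp ω]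
    · have : 1 ≤ 4 * (Φ ω - m) ^ 2 / m ^ 2 := by
        rw [le_div_iff₀ hm2]; nlinarith
      nlinarith [hp ω]
  have h2 : ∑ ω ∈ Finset.univ.filter (fun ω => m / 2 < Φ ω), q ω ≤
      4 * (∑ ω, q ω * Φ ω ^ 2) / m ^ 2 := by
    rw [Finset.sum_filter, mul_div_right_comm, Finset.mul_sum]
    refine Finset.sum_le_sum fun ω _ => ?_
    have h0 : 0 ≤ 4 / m ^ 2 * (q ω * Φ ω ^ 2) :=
      mul_nonneg (by positivity) (mul_nonneg (hq ω) (sq_nonneg _))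
    split_ifs with h
    · have : 1 ≤ 4 / m ^ 2 * Φ ω ^ 2 := by
        rw [div_mul_eq_mul_div, le_div_iff₀ hm2]; nlinarith
      nlinarith [hq ω]
    · exact h0
  linarith

end TotalVariation

/-! ### Distance of product laws to equilibrium, and moments of linear statistics. -/

section ProductLaw

variable {V ι : Type*} [Fintype V] [DecidableEq V] [Fintype ι] [DecidableEq ι] {k : ℕ}

theorem one_le_sum_sq_div {w η : V → ℝ} (hw : IsSiteWeight w) (hη : IsProbVec η) :
    1 ≤ ∑ v, η v ^ 2 / w v := by
  have := Finset.sq_sum_div_le_sum_sq_div Finset.univ η (fun v _ => hw.pos v)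
  rwa [hη.sum_eq_one, hw.sum_eq_one, one_pow, div_one] at this

theorem productLaw_sub_multinomial_sq_le_one (hι : Fintype.card ι = k) {w : V → ℝ}
    (hw : IsSiteWeight w) {η : ι → V → ℝ} (hη : ∀ i, IsProbVec (η i)) (A : Finset (Config V k)) :
    (∑ ζ ∈ A, productLaw hι η ζ - ∑ ζ ∈ A, multinomial w k ζ) ^ 2 ≤ 1 := by
  have b : ∀ {η : ι → V → ℝ}, (∀ i, IsProbVec (η i)) →
      0 ≤ ∑ ζ ∈ A, productLaw hι η ζ ∧ ∑ ζ ∈ A, productLaw hι η ζ ≤ 1 := by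
    intro η hη
    refine ⟨Finset.sum_nonneg fun ζ _ => productLaw_nonneg hι hη ζ, ?_⟩
    rw [← sum_productLaw hι hη]
    exact Finset.sum_le_univ_sum_of_nonneg fun ζ => productLaw_nonneg hι hη ζ
  have b1 := b hη
  have b2 := b (η := fun _ => w) fun _ => hw.isProbVec
  rw [multinomial_eq_productLaw hι, ← sq_abs]
  exact pow_le_one₀ (abs_nonneg _) (abs_le.2 ⟨by linarith, by linarith⟩)

/-- A bound for the total variation distance of product laws through the sum of the `χ²`-distances
of the factors. -/
theorem productLaw_sub_multinomial_sq_le (hι : Fintype.card ι = k) {w : V → ℝ}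
    (hw : IsSiteWeight w) {η : ι → V → ℝ} (hη : ∀ i, IsProbVec (η i)) (A : Finset (Config V k)) :
    (∑ ζ ∈ A, productLaw hι η ζ - ∑ ζ ∈ A, multinomial w k ζ) ^ 2 ≤
      2 * ∑ i, (∑ v, η i v ^ 2 / w v - 1) := by
  set S := ∑ i, (∑ v, η i v ^ 2 / w v - 1) with hS
  have hS0 : 0 ≤ S := Finset.sum_nonneg fun i _ => sub_nonneg.2 (one_le_sum_sq_div hw (hη i))
  rw [multinomial_eq_productLaw hι]
  rcases le_total 1 S with h1 | h1
  · have := productLaw_sub_multinomial_sq_le_one hι hw hη A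
    rw [multinomial_eq_productLaw hι] at this
    linarith
  · let a : (ι → V) → ℝ := fun x => ∏ i, η i (x i)
    let b : (ι → V) → ℝ := fun x => ∏ i, w (x i)
    let g : (ι → V) → ℝ := fun x => if countConfig hι x ∈ A then 1 else 0
    have hb : ∀ x, 0 < b x := fun x => Finset.prod_pos fun i _ => hw.pos _
    have hb1 : ∑ x, b x = 1 := by
      simp only [b]
      rw [sum_pi_prod (fun _ => w)]; simp [hw.sum_eq_one]
    have ha1 : ∑ x, a x = 1 := by
      simp only [a]
      rw [sum_pi_prod]; exact Finset.prod_eq_one fun i _ => (hη i).sum_eq_one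
    have hA : ∀ η : ι → V → ℝ, ∑ ζ ∈ A, productLaw hι η ζ = ∑ x, (∏ i, η i (x i)) * g x := by
      intro η
      rw [← sum_productLaw_mul hι η fun ζ => if ζ ∈ A then 1 else 0]
      simp
    have e1 : ∑ ζ ∈ A, productLaw hι η ζ - ∑ ζ ∈ A, productLaw hι (fun _ => w) ζ =
        ∑ x, (a x - b x) * g x := by
      rw [hA, hA, ← Finset.sum_sub_distrib]
      exact Finset.sum_congr rfl fun x _ => by simp only [a, b]; ring
    -- Cauchy–Schwarz with weights `b` bounds the squared discrepancy by the χ²-distance of the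
    -- labelled laws, which is a product over particles minus one.
    have e2 := Finset.sq_sum_div_le_sum_sq_div Finset.univ (fun x => (a x - b x) * g x)
      (fun x _ => hb x)
    rw [hb1, div_one] at e2
    have e3 : ∑ x, ((a x - b x) * g x) ^ 2 / b x ≤ ∑ x, (a x ^ 2 / b x - 2 * a x + b x) := by
      refine Finset.sum_le_sum fun x _ => ?_
      have : a x ^ 2 / b x - 2 * a x + b x = (a x - b x) ^ 2 / b x := by
        have := (hb x).ne'; field_simp; ring
      rw [this, div_le_div_iff_of_pos_right (hb x), mul_pow]
      refine mul_le_of_le_one_right (sq_nonneg _) ?_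
      simp only [g]; split_ifs <;> norm_num
    have e4 : ∑ x, a x ^ 2 / b x = ∏ i, ∑ v, η i v ^ 2 / w v := by
      rw [← sum_pi_prod (fun i v => η i v ^ 2 / w v)]
      refine Finset.sum_congr rfl fun x _ => ?_
      simp only [a, b]
      rw [Finset.prod_div_distrib, Finset.prod_pow]
    have e5 : ∏ i, ∑ v, η i v ^ 2 / w v ≤ Real.exp S := by
      rw [hS, Real.exp_sum]
      refine Finset.prod_le_prod (fun i _ => ?_) (fun i _ => ?_)
      · linarith [one_le_sum_sq_div hw (hη i)]
      · have := Real.add_one_le_exp (∑ v, η i v ^ 2 / w v - 1)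
        linarith
    -- For `S ≤ 1` one has `exp S - 1 ≤ 2 * S`; the case `1 ≤ S` was trivial.
    have e6 := (abs_le.1 (Real.abs_exp_sub_one_le (x := S) (by rwa [abs_of_nonneg hS0]))).2
    rw [abs_of_nonneg hS0] at e6
    rw [Finset.sum_add_distrib, Finset.sum_sub_distrib, ← Finset.mul_sum, ha1, hb1, e4] at e3
    rw [e1]
    linarith

/-- The linear statistic of a configuration with coefficients `ψ`. -/
def linearStat (ψ : V → ℝ) (ζ : Config V k) : ℝ := ∑ v, (ζ.1 v : ℝ) * ψ v

theorem linearStat_countConfig (hι : Fintype.card ι = k) (ψ : V → ℝ) (x : ι → V) :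
    linearStat ψ (countConfig hι x) = ∑ i, ψ (x i) := by
  rw [← Finset.sum_fiberwise_of_maps_to (g := x) (t := Finset.univ) (fun _ _ => Finset.mem_univ _)]
  refine Finset.sum_congr rfl fun v _ => ?_
  rw [Finset.sum_congr rfl (g := fun _ => ψ v)
    (fun i hi => by rw [(Finset.mem_filter.1 hi).2]), Finset.sum_const, nsmul_eq_mul]
  rfl

theorem sum_productLaw_linearStat (hι : Fintype.card ι = k) {η : V → ℝ} (hη : IsProbVec η)
    (ψ : V → ℝ) : ∑ ζ, productLaw hι (fun _ => η) ζ * linearStat ψ ζ = k * (η ⬝ᵥ ψ) := by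
  rw [sum_productLaw_mul]
  simp only [linearStat_countConfig, Finset.mul_sum]
  rw [Finset.sum_comm]
  have : ∀ j : ι, ∑ x : ι → V, (∏ i, η (x i)) * ψ (x j) = η ⬝ᵥ ψ := by
    intro j
    have e : ∀ x : ι → V, (∏ i, η (x i)) * ψ (x j) =
        ∏ i, (η (x i) * if i = j then ψ (x i) else 1) := by
      intro x
      rw [Finset.prod_mul_distrib]
      simp
    simp only [e]
    rw [sum_pi_prod (fun i v => η v * if i = j then ψ v else 1), Finset.prod_eq_single j]
    · simp [dotProduct]
    · intro i _ hij; simp [hij, hη.sum_eq_one]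
    · simp
  simp only [this, Finset.sum_const, Finset.card_univ, hι, nsmul_eq_mul]

/-- Distinct particles are independent and give exactly `(η ⬝ᵥ ψ) ^ 2`; each diagonal term is at
most `B ^ 2`. Adding the square on the diagonal too keeps the bound affine in `tensor η η`. -/
theorem sum_productLaw_linearStat_sq_le (hι : Fintype.card ι = k) {η : V → ℝ} (hη : IsProbVec η)
    {ψ : V → ℝ} {B : ℝ} (hψ : ∀ v, ψ v ^ 2 ≤ B ^ 2) :
    ∑ ζ, productLaw hι (fun _ => η) ζ * linearStat ψ ζ ^ 2 ≤
      k * B ^ 2 + k ^ 2 * (η ⬝ᵥ ψ) ^ 2 := by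
  rw [sum_productLaw_mul]
  have e0 : ∀ x : ι → V, (∏ i, η (x i)) * linearStat ψ (countConfig hι x) ^ 2 =
      ∑ j, ∑ l, (∏ i, η (x i)) * (ψ (x j) * ψ (x l)) := by
    intro x
    rw [linearStat_countConfig, sq, Finset.sum_mul_sum]
    simp only [Finset.mul_sum]
  simp only [e0]
  rw [Finset.sum_comm]
  have hprod : ∑ x : ι → V, ∏ i, η (x i) = 1 := by
    rw [sum_pi_prod (fun _ => η)]; simp [hη.sum_eq_one]
  have hb : ∀ j l : ι, ∑ x : ι → V, (∏ i, η (x i)) * (ψ (x j) * ψ (x l)) ≤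
      (if j = l then B ^ 2 else 0) + (η ⬝ᵥ ψ) ^ 2 := by
    intro j l
    by_cases hjl : j = l
    · subst hjl
      rw [if_pos rfl]
      have : ∑ x : ι → V, (∏ i, η (x i)) * (ψ (x j) * ψ (x j)) ≤
          ∑ x : ι → V, (∏ i, η (x i)) * B ^ 2 :=
        Finset.sum_le_sum fun x _ => mul_le_mul_of_nonneg_left
          (by rw [← sq]; exact hψ _) (Finset.prod_nonneg fun i _ => hη.nonneg _)
      rw [← Finset.sum_mul, hprod, one_mul] at this
      linarith [sq_nonneg (η ⬝ᵥ ψ)]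
    · rw [if_neg hjl, zero_add]
      have e : ∀ x : ι → V, (∏ i, η (x i)) * (ψ (x j) * ψ (x l)) =
          ∏ i, (η (x i) * ((if i = j then ψ (x i) else 1) * if i = l then ψ (x i) else 1)) := by
        intro x
        rw [Finset.prod_mul_distrib, Finset.prod_mul_distrib]
        simp
      simp only [e]
      rw [sum_pi_prod
        (fun i v => η v * ((if i = j then ψ v else 1) * if i = l then ψ v else 1))]
      have e' : ∀ i, ∑ v, η v * ((if i = j then ψ v else 1) * if i = l then ψ v else 1) =
          (if i = j then η ⬝ᵥ ψ else 1) * if i = l then η ⬝ᵥ ψ else 1 := by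
        intro i
        by_cases h1 : i = j
        · have h2 : i ≠ l := fun h => hjl (h1 ▸ h)
          simp [h1, hjl, dotProduct]
        · by_cases h2 : i = l
          · simp [h2, Ne.symm hjl, dotProduct]
          · simp [h1, h2, hη.sum_eq_one]
      simp only [e', Finset.prod_mul_distrib]
      simp [sq]
  have hcomm : ∀ j : ι, ∑ x : ι → V, ∑ l, (∏ i, η (x i)) * (ψ (x j) * ψ (x l)) ≤
      B ^ 2 + k * (η ⬝ᵥ ψ) ^ 2 := by
    intro j
    rw [Finset.sum_comm]
    refine (Finset.sum_le_sum fun l _ => hb j l).trans_eq ?_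
    rw [Finset.sum_add_distrib]
    simp [hι]
  refine (Finset.sum_le_sum fun j _ => hcomm j).trans_eq ?_
  simp only [Finset.sum_const, Finset.card_univ, hι, nsmul_eq_mul]
  ring

end ProductLaw

/-! ### Spectral theory of the one-particle process. -/

section OneParticle

variable {V : Type*} [Fintype V] [DecidableEq V]

/-- The generator of the one-particle process, in terms of the position of the particle. -/
noncomputable def siteGenerator (c : V → V → ℝ) (w : V → ℝ) : Matrix V V ℝ :=
  ∑ e : V × V, (c e.1 e.2 / 2) • (edgeKernel w e.1 e.2 - 1)

theorem generator_eq_sum (c : V → V → ℝ) (w : V → ℝ) (k : ℕ) :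
    generator c w k = ∑ e : V × V, (c e.1 e.2 / 2) • (splitMatrix w k e.1 e.2 - 1) := by
  rw [generator, Fintype.sum_prod_type, Finset.smul_sum]
  refine Finset.sum_congr rfl fun x _ => ?_
  rw [Finset.smul_sum]
  refine Finset.sum_congr rfl fun y _ => ?_
  rw [smul_smul]; congr 1; ring

theorem siteGenerator_mulVec (c : V → V → ℝ) (w : V → ℝ) (ψ : V → ℝ) :
    siteGenerator c w *ᵥ ψ =
      -∑ e : V × V, (c e.1 e.2 / 2 * (ψ e.1 - ψ e.2)) • edgeVec w e.1 e.2 := by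
  rw [siteGenerator, Matrix.sum_mulVec, ← Finset.sum_neg_distrib]
  refine Finset.sum_congr rfl fun e _ => ?_
  rw [Matrix.smul_mulVec, Matrix.sub_mulVec, Matrix.one_mulVec, edgeKernel_mulVec, sub_sub_cancel_left,
    smul_neg, smul_smul]

/-- Reversibility in infinitesimal form: weighting by `w` makes the rank-one part of an update
symmetric. Self-adjointness and the formula for the Dirichlet form rest on it. -/
theorem mul_edgeVec {w : V → ℝ} (x y v : V) :
    w v * edgeVec w x y v =
      w x * w y / (w x + w y) * (Pi.single x 1 - Pi.single y 1 : V → ℝ) v := by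
  simp only [edgeVec, Pi.smul_apply, Pi.sub_apply, smul_eq_mul, Pi.single_apply]
  split_ifs with h1 h2 h2
  · subst h1; subst h2; ring
  · subst h1; ring
  · subst h2; ring
  · ring

/-- The Dirichlet form as a sum over all ordered pairs of sites. -/
theorem dirichletForm_eq_sum (c : V → V → ℝ) (w : V → ℝ) (ψ : V → ℝ) :
    dirichletForm c w ψ =
      ∑ e : V × V, c e.1 e.2 / 2 * (w e.1 * w e.2 / (w e.1 + w e.2)) * (ψ e.1 - ψ e.2) ^ 2 := by
  rw [dirichletForm, Fintype.sum_prod_type, Finset.mul_sum]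
  refine Finset.sum_congr rfl fun x _ => ?_
  rw [Finset.mul_sum]
  exact Finset.sum_congr rfl fun y _ => by ring

theorem dirichletForm_nonneg {c : V → V → ℝ} (hc : ∀ x y, 0 ≤ c x y) {w : V → ℝ}
    (hw : ∀ v, 0 < w v) (ψ : V → ℝ) : 0 ≤ dirichletForm c w ψ := by
  rw [dirichletForm_eq_sum]
  refine Finset.sum_nonneg fun e _ => ?_
  have := hc e.1 e.2; have := hw e.1; have := hw e.2
  positivity

theorem sum_mul_siteGenerator_mulVec (c : V → V → ℝ) (w ψ : V → ℝ) :
    ∑ v, w v * (ψ v * (-(siteGenerator c w *ᵥ ψ)) v) = dirichletForm c w ψ := by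
  rw [siteGenerator_mulVec, neg_neg, dirichletForm_eq_sum]
  simp only [Finset.sum_apply, Pi.smul_apply, smul_eq_mul, Finset.mul_sum]
  rw [Finset.sum_comm]
  refine Finset.sum_congr rfl fun e _ => ?_
  have : ∀ v, w v * (ψ v * (c e.1 e.2 / 2 * (ψ e.1 - ψ e.2) * edgeVec w e.1 e.2 v)) =
      c e.1 e.2 / 2 * (ψ e.1 - ψ e.2) * (w e.1 * w e.2 / (w e.1 + w e.2)) *
        (ψ v * (Pi.single e.1 1 - Pi.single e.2 1 : V → ℝ) v) := by
    intro v
    have := mul_edgeVec (w := w) e.1 e.2 v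
    linear_combination (ψ v * (c e.1 e.2 / 2 * (ψ e.1 - ψ e.2))) * this
  simp only [this]
  rw [← Finset.mul_sum]
  have h : ∑ v, ψ v * (Pi.single e.1 1 - Pi.single e.2 1 : V → ℝ) v = ψ e.1 - ψ e.2 := by
    simp [mul_sub, Pi.single_apply]
  rw [h]; ring

theorem sum_mul_siteGenerator (c : V → V → ℝ) (w ψ : V → ℝ) :
    ∑ v, w v * (siteGenerator c w *ᵥ ψ) v = 0 := by
  rw [siteGenerator_mulVec]
  simp only [Pi.neg_apply, Finset.sum_apply, Pi.smul_apply, smul_eq_mul, Finset.mul_sum, mul_neg,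
    Finset.sum_neg_distrib]
  rw [Finset.sum_comm, neg_eq_zero]
  refine Finset.sum_eq_zero fun e _ => ?_
  have : ∀ v, w v * (c e.1 e.2 / 2 * (ψ e.1 - ψ e.2) * edgeVec w e.1 e.2 v) =
      c e.1 e.2 / 2 * (ψ e.1 - ψ e.2) * (w e.1 * w e.2 / (w e.1 + w e.2)) *
        (Pi.single e.1 1 - Pi.single e.2 1 : V → ℝ) v := by
    intro v
    have := mul_edgeVec (w := w) e.1 e.2 v
    linear_combination (c e.1 e.2 / 2 * (ψ e.1 - ψ e.2)) * this
  simp only [this]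
  rw [← Finset.mul_sum]
  simp [Pi.single_apply]

theorem siteGenerator_symm (c : V → V → ℝ) (w : V → ℝ) (x y : V) :
    w x * siteGenerator c w x y = w y * siteGenerator c w y x := by
  simp only [siteGenerator, Matrix.sum_apply, Finset.mul_sum]
  refine Finset.sum_congr rfl fun e _ => ?_
  simp only [edgeKernel, sub_sub_cancel_left, Matrix.smul_apply, Matrix.neg_apply,
    Matrix.vecMulVec_apply, smul_eq_mul]
  have h1 := mul_edgeVec (w := w) e.1 e.2 x
  have h2 := mul_edgeVec (w := w) e.1 e.2 y
  linear_combination (-(c e.1 e.2 / 2) * (Pi.single e.1 1 - Pi.single e.2 1 : V → ℝ) y) * h1 +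
    (c e.1 e.2 / 2) * (Pi.single e.1 1 - Pi.single e.2 1 : V → ℝ) x * h2

/-- The configuration of one particle at `v`. -/
def pointConfig (v : V) : Config V 1 := countConfig (ι := Unit) Fintype.card_unit fun _ => v

theorem sum_productLaw_unit (η : V → ℝ) (f : Config V 1 → ℝ) :
    ∑ ζ, productLaw (ι := Unit) Fintype.card_unit (fun _ => η) ζ * f ζ = ∑ v, η v * f (pointConfig v) := by
  rw [sum_productLaw_mul]
  refine Fintype.sum_equiv (Equiv.funUnique Unit V) _ _ fun x => ?_
  simp [pointConfig]

theorem sum_multinomial_one (w : V → ℝ) (f : Config V 1 → ℝ) :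
    ∑ ζ, multinomial w 1 ζ * f ζ = ∑ v, w v * f (pointConfig v) := by
  rw [multinomial_eq_productLaw (ι := Unit) Fintype.card_unit, sum_productLaw_unit]

theorem splitMatrix_one_mulVec {w : V → ℝ} (hw : ∀ v, 0 < w v) {x y : V} (hxy : x ≠ y)
    (f : Config V 1 → ℝ) (v : V) :
    (splitMatrix w 1 x y *ᵥ f) (pointConfig v) =
      (edgeKernel w x y *ᵥ fun u => f (pointConfig u)) v := by
  have h1 := productLaw_vecMul_splitMatrix (ι := Unit) (k := 1) Fintype.card_unit hw hxy
    (fun _ => Pi.single v (1 : ℝ))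
  rw [productLaw_single] at h1
  have h2 : (splitMatrix w 1 x y *ᵥ f) (pointConfig v) =
      (Pi.single (pointConfig v) 1 ᵥ* splitMatrix w 1 x y) ⬝ᵥ f := by
    rw [← Matrix.dotProduct_mulVec, single_one_dotProduct]
  have h3 : (edgeKernel w x y *ᵥ fun u => f (pointConfig u)) v =
      (Pi.single v 1 ᵥ* edgeKernel w x y) ⬝ᵥ fun u => f (pointConfig u) := by
    rw [← Matrix.dotProduct_mulVec, single_one_dotProduct]
  rw [h2, h3]
  unfold pointConfig
  rw [h1]
  exact sum_productLaw_unit _ f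

theorem generator_one_mulVec {c : V → V → ℝ} (hc : ∀ x, c x x = 0) {w : V → ℝ} (hw : ∀ v, 0 < w v)
    (f : Config V 1 → ℝ) (v : V) :
    (generator c w 1 *ᵥ f) (pointConfig v) =
      (siteGenerator c w *ᵥ fun u => f (pointConfig u)) v := by
  rw [generator_eq_sum, siteGenerator, Matrix.sum_mulVec, Matrix.sum_mulVec, Finset.sum_apply,
    Finset.sum_apply]
  refine Finset.sum_congr rfl fun e _ => ?_
  rcases eq_or_ne e.1 e.2 with h | h
  · rw [h, hc]; simp
  · rw [Matrix.smul_mulVec, Matrix.smul_mulVec, Pi.smul_apply, Pi.smul_apply, Matrix.sub_mulVec,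
      Matrix.sub_mulVec, Pi.sub_apply, Pi.sub_apply, splitMatrix_one_mulVec hw h,
      Matrix.one_mulVec, Matrix.one_mulVec]

/-- The Rayleigh quotients of the one-particle process, in terms of the position of the particle. -/
theorem rayleigh_eq {c : V → V → ℝ} (hc : ∀ x, c x x = 0) {w : V → ℝ} (hw : ∀ v, 0 < w v)
    (f : Config V 1 → ℝ) :
    (∑ ξ, multinomial w 1 ξ * (f ξ * (-(generator c w 1 *ᵥ f)) ξ)) /
        ∑ ξ, multinomial w 1 ξ * f ξ ^ 2 =
      dirichletForm c w (fun v => f (pointConfig v)) / ∑ v, w v * f (pointConfig v) ^ 2 := by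
  rw [sum_multinomial_one w fun ξ => f ξ ^ 2,
    sum_multinomial_one w fun ξ => f ξ * (-(generator c w 1 *ᵥ f)) ξ,
    ← sum_mul_siteGenerator_mulVec]
  simp only [Pi.neg_apply, generator_one_mulVec hc hw]

theorem spectralGap_nonneg {c : V → V → ℝ} (hc : IsConductance c) {w : V → ℝ}
    (hw : IsSiteWeight w) : 0 ≤ spectralGap c w 1 := by
  refine Real.sInf_nonneg ?_
  rintro r ⟨f, -, -, rfl⟩
  rw [rayleigh_eq hc.diag hw.pos]
  exact div_nonneg (dirichletForm_nonneg hc.nonneg hw.pos _)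
    (Finset.sum_nonneg fun v _ => mul_nonneg (hw.pos v).le (sq_nonneg _))

theorem sum_mul_sq_pos {w : V → ℝ} (hw : ∀ v, 0 < w v) {ψ : V → ℝ} (hψ : ψ ≠ 0) :
    0 < ∑ v, w v * ψ v ^ 2 := by
  obtain ⟨v, hv⟩ := Function.ne_iff.1 hψ
  exact Finset.sum_pos' (fun v _ => mul_nonneg (hw v).le (sq_nonneg _))
    ⟨v, Finset.mem_univ v, mul_pos (hw v) (sq_pos_of_ne_zero hv)⟩

theorem spectralGap_mul_le {c : V → V → ℝ} (hc : IsConductance c) {w : V → ℝ}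
    (hw : IsSiteWeight w) {ψ : V → ℝ} (hψ : ∑ v, w v * ψ v = 0) :
    spectralGap c w 1 * ∑ v, w v * ψ v ^ 2 ≤ dirichletForm c w ψ := by
  rcases eq_or_ne ψ 0 with h0 | h0
  · subst h0; simpa using dirichletForm_nonneg hc.nonneg hw.pos (0 : V → ℝ)
  -- `linearStat ψ` extends `ψ` to a test function on one-particle configurations.
  have hf : ∀ v, linearStat ψ (pointConfig v) = ψ v := fun v => by
    rw [pointConfig, linearStat_countConfig]; simp
  rw [← le_div_iff₀ (sum_mul_sq_pos hw.pos h0)]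
  refine csInf_le ⟨0, ?_⟩ ⟨linearStat ψ, ?_, ?_, ?_⟩
  · rintro r ⟨f, -, -, rfl⟩
    rw [rayleigh_eq hc.diag hw.pos]
    exact div_nonneg (dirichletForm_nonneg hc.nonneg hw.pos _)
      (Finset.sum_nonneg fun v _ => mul_nonneg (hw.pos v).le (sq_nonneg _))
  · intro h
    refine h0 (funext fun v => ?_)
    rw [← hf v, h]; rfl
  · rw [sum_multinomial_one]; simpa only [hf] using hψ
  · rw [rayleigh_eq hc.diag hw.pos]; simp only [hf]

theorem le_spectralGap {c : V → V → ℝ} (hc : IsConductance c) {w : V → ℝ} (hw : IsSiteWeight w)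
    (hgap : spectralGap c w 1 ≠ 0) {r : ℝ}
    (h : ∀ ψ : V → ℝ, ∑ v, w v * ψ v = 0 → r * ∑ v, w v * ψ v ^ 2 ≤ dirichletForm c w ψ) :
    r ≤ spectralGap c w 1 := by
  refine le_csInf ?_ ?_
  -- Without admissible test functions the infimum would be `sInf ∅ = 0`, which the positivity of
  -- the gap excludes.
  · by_contra hne
    rw [Set.not_nonempty_iff_eq_empty] at hne
    exact hgap (by rw [spectralGap, hne, Real.sInf_empty])
  · rintro s ⟨f, hf0, hf, rfl⟩
    rw [rayleigh_eq hc.diag hw.pos]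
    have hψ : (fun v => f (pointConfig v)) ≠ 0 := by
      intro h0
      -- A function vanishing on every `pointConfig` has norm zero, and the multinomial weights are
      -- strictly positive.
      have h1 : ∑ ξ, multinomial w 1 ξ * f ξ ^ 2 = 0 := by
        rw [sum_multinomial_one w fun ξ => f ξ ^ 2]
        exact Finset.sum_eq_zero fun v _ => by rw [show f (pointConfig v) = 0 from congrFun h0 v]; simp
      have hm : ∀ ξ, 0 < multinomial w 1 ξ := fun ξ =>
        mul_pos (by positivity) (Finset.prod_pos fun v _ => div_pos (pow_pos (hw.pos v) _)
          (by positivity))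
      rw [Finset.sum_eq_zero_iff_of_nonneg fun ξ _ => mul_nonneg (hm ξ).le (sq_nonneg _)] at h1
      refine hf0 (funext fun ξ => ?_)
      have := h1 ξ (Finset.mem_univ ξ)
      simpa [(hm ξ).ne'] using this
    rw [le_div_iff₀ (sum_mul_sq_pos hw.pos hψ)]
    exact h _ (by rwa [sum_multinomial_one] at hf)

/-- An orthonormal basis of eigenfunctions of the one-particle process. -/
structure IsEigenbasis (c : V → V → ℝ) (w : V → ℝ) (lam : V → ℝ) (b : V → V → ℝ) : Prop where
  orthonormal : ∀ i j, ∑ v, w v * (b i v * b j v) = if i = j then 1 else 0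
  complete : ∀ x y, ∑ i, b i x * b i y = if x = y then 1 / w x else 0
  eigen : ∀ i, siteGenerator c w *ᵥ b i = -lam i • b i

/-- Conjugating the negative generator by `√w` makes it a symmetric matrix; its eigenvectors divided
by `√w` form the basis. -/
theorem exists_isEigenbasis (c : V → V → ℝ) {w : V → ℝ} (hw : ∀ v, 0 < w v) :
    ∃ lam b, IsEigenbasis c w lam b := by
  let A : Matrix V V ℝ := Matrix.of fun x y =>
    -(w x * siteGenerator c w x y) / (√(w x) * √(w y))
  have hA : A.IsHermitian := by
    ext x y
    simp only [A, Matrix.conjTranspose_apply, Matrix.of_apply, star_trivial]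
    rw [siteGenerator_symm c w y x, mul_comm (√(w y))]
  have hs : ∀ v, 0 < √(w v) := fun v => Real.sqrt_pos.2 (hw v)
  have hs2 : ∀ v, w v = √(w v) * √(w v) := fun v => (Real.mul_self_sqrt (hw v).le).symm
  let u := hA.eigenvectorBasis
  have ho : ∀ i j, ∑ v, u i v * u j v = if i = j then 1 else 0 := by
    intro i j
    rw [← orthonormal_iff_ite.1 u.orthonormal i j]
    simp [PiLp.inner_apply, mul_comm]
  have hcomp : ∀ x y, ∑ i, u i x * u i y = if x = y then 1 else 0 := by
    intro x y
    have := u.sum_inner_mul_inner (EuclideanSpace.single y (1 : ℝ)) (EuclideanSpace.single x 1)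
    simpa [EuclideanSpace.inner_single_left, EuclideanSpace.inner_single_right, mul_comm] using this
  refine ⟨hA.eigenvalues, fun i v => u i v / √(w v), fun i j => ?_, fun x y => ?_, fun i => ?_⟩
  · rw [← ho]
    refine Finset.sum_congr rfl fun v _ => ?_
    have := (hs v).ne'
    nth_rewrite 1 [hs2 v]
    field_simp
  · have : ∀ i, u i x / √(w x) * (u i y / √(w y)) = (u i x * u i y) / (√(w x) * √(w y)) := by
      intro i; ring
    simp only [this]
    rw [← Finset.sum_div, hcomp]
    split_ifs with h
    · subst h; rw [← hs2]
    · simp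
  · have h := hA.mulVec_eigenvectorBasis i
    ext x
    have hx := congrFun h x
    simp only [Matrix.mulVec, dotProduct, A, Matrix.of_apply, Pi.smul_apply, smul_eq_mul] at hx
    simp only [Matrix.mulVec, dotProduct, Pi.smul_apply, smul_eq_mul]
    have e : ∀ y, siteGenerator c w x y * (u i y / √(w y)) =
        -(1 / √(w x)) * (-(w x * siteGenerator c w x y) / (√(w x) * √(w y)) * u i y) := by
      intro y
      have := (hs x).ne'; have := (hs y).ne'
      nth_rewrite 2 [hs2 x]
      field_simp
    simp only [e, ← Finset.mul_sum]
    rw [show ∑ y, -(w x * siteGenerator c w x y) / (√(w x) * √(w y)) * u i y = _ from hx]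
    ring

namespace IsEigenbasis

variable {c : V → V → ℝ} {w lam : V → ℝ} {b : V → V → ℝ}

theorem sum_sq (hb : IsEigenbasis c w lam b) (i : V) : ∑ v, w v * b i v ^ 2 = 1 := by
  have := hb.orthonormal i i
  rw [if_pos rfl] at this
  rw [← this]
  exact Finset.sum_congr rfl fun v _ => by ring

theorem dirichletForm_eq (hb : IsEigenbasis c w lam b) (i : V) :
    dirichletForm c w (b i) = lam i := by
  rw [← sum_mul_siteGenerator_mulVec, hb.eigen]
  have : ∀ v, w v * (b i v * (-(-lam i • b i)) v) = lam i * (w v * b i v ^ 2) := by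
    intro v; simp; ring
  simp only [this, ← Finset.mul_sum, hb.sum_sq, mul_one]

theorem sum_eq_zero (hb : IsEigenbasis c w lam b) {i : V} (hi : lam i ≠ 0) :
    ∑ v, w v * b i v = 0 := by
  have := sum_mul_siteGenerator c w (b i)
  rw [hb.eigen] at this
  have e : ∀ v, w v * (-lam i • b i) v = -lam i * (w v * b i v) := by intro v; simp; ring
  simp only [e, ← Finset.mul_sum] at this
  exact (mul_eq_zero.1 this).resolve_left (neg_ne_zero.2 hi)

theorem gap_le (hb : IsEigenbasis c w lam b) (hc : IsConductance c) (hw : IsSiteWeight w) {i : V}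
    (hi : lam i ≠ 0) : spectralGap c w 1 ≤ lam i := by
  have := spectralGap_mul_le hc hw (hb.sum_eq_zero hi)
  rwa [hb.sum_sq, mul_one, hb.dirichletForm_eq] at this

/-- The centred eigenfunction has Dirichlet form zero, so the Poincaré inequality kills its
variance. -/
theorem eq_const (hb : IsEigenbasis c w lam b) (hc : IsConductance c) (hw : IsSiteWeight w)
    (hgap : 0 < spectralGap c w 1) {i : V} (hi : lam i = 0) :
    ∀ v, b i v = ∑ u, w u * b i u := by
  set m := ∑ u, w u * b i u with hm
  have h0 : ∑ v, w v * (b i v - m) = 0 := by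
    simp only [mul_sub, Finset.sum_sub_distrib, ← Finset.sum_mul, hw.sum_eq_one, one_mul]
    rw [← hm, sub_self]
  have h1 := spectralGap_mul_le hc hw h0
  have h2 : dirichletForm c w (fun v => b i v - m) = 0 := by
    rw [← hi, ← hb.dirichletForm_eq i]
    simp [dirichletForm]
  rw [h2] at h1
  by_contra hne
  push Not at hne
  obtain ⟨v, hv⟩ := hne
  have := sum_mul_sq_pos hw.pos (ψ := fun v => b i v - m)
    (Function.ne_iff.2 ⟨v, sub_ne_zero.2 hv⟩)
  exact absurd h1 (not_le.2 (mul_pos hgap this))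

/-- There is at most one constant eigenfunction. -/
theorem eq_of_lam_eq_zero (hb : IsEigenbasis c w lam b) (hc : IsConductance c)
    (hw : IsSiteWeight w) (hgap : 0 < spectralGap c w 1) {i j : V} (hi : lam i = 0)
    (hj : lam j = 0) : i = j := by
  by_contra hij
  have h1 := hb.orthonormal i j
  have h2 := hb.sum_sq i
  have h3 := hb.sum_sq j
  rw [if_neg hij] at h1
  have ei := hb.eq_const hc hw hgap hi
  have ej := hb.eq_const hc hw hgap hj
  set p := ∑ u, w u * b i u
  set q := ∑ u, w u * b j u
  simp only [ei, ej, ← Finset.sum_mul, hw.sum_eq_one, one_mul] at h1 h2 h3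
  rcases mul_eq_zero.1 h1 with h | h
  · rw [h] at h2; norm_num at h2
  · rw [h] at h3; norm_num at h3

theorem expansion (hb : IsEigenbasis c w lam b) (hw : ∀ v, 0 < w v) (ψ : V → ℝ) :
    ψ = ∑ i, (∑ v, w v * (ψ v * b i v)) • b i := by
  ext x
  simp only [Finset.sum_apply, Pi.smul_apply, smul_eq_mul, Finset.sum_mul]
  rw [Finset.sum_comm]
  have : ∀ v, ∑ i, w v * (ψ v * b i v) * b i x = if v = x then ψ x else 0 := by
    intro v
    have e : ∀ i, w v * (ψ v * b i v) * b i x = w v * ψ v * (b i v * b i x) := by intro i; ring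
    simp only [e, ← Finset.mul_sum, hb.complete]
    split_ifs with h
    · subst h; have := (hw v).ne'; field_simp
    · simp
  simp [this]

theorem sum_mul_eq (hb : IsEigenbasis c w lam b) (hw : ∀ v, 0 < w v) (ψ χ : V → ℝ) :
    ∑ v, w v * (ψ v * χ v) =
      ∑ i, (∑ v, w v * (ψ v * b i v)) * ∑ v, w v * (χ v * b i v) := by
  set a : V → ℝ := fun i => ∑ v, w v * (χ v * b i v) with ha
  have hχ : ∀ v, χ v = ∑ i, a i * b i v := fun v => by
    have := congrFun (hb.expansion hw χ) v
    simpa only [Finset.sum_apply, Pi.smul_apply, smul_eq_mul] using this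
  have e : ∀ v, w v * (ψ v * χ v) = ∑ i, w v * (ψ v * b i v) * a i := by
    intro v
    rw [hχ v, Finset.mul_sum, Finset.mul_sum]
    exact Finset.sum_congr rfl fun i _ => by ring
  simp only [e]
  rw [Finset.sum_comm]
  exact Finset.sum_congr rfl fun i _ => (Finset.sum_mul _ _ _).symm

theorem dirichletForm_eq_sum_sq (hb : IsEigenbasis c w lam b) (hw : ∀ v, 0 < w v) (ψ : V → ℝ) :
    dirichletForm c w ψ = ∑ i, lam i * (∑ v, w v * (ψ v * b i v)) ^ 2 := by
  set a : V → ℝ := fun i => ∑ v, w v * (ψ v * b i v) with ha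
  have hL : ∀ v, (-(siteGenerator c w *ᵥ ψ)) v = ∑ i, lam i * a i * b i v := fun v => by
    nth_rewrite 1 [hb.expansion hw ψ]
    rw [Matrix.mulVec_sum]
    simp only [Pi.neg_apply, Finset.sum_apply, Matrix.mulVec_smul, hb.eigen, Pi.smul_apply,
      smul_eq_mul, ← Finset.sum_neg_distrib]
    exact Finset.sum_congr rfl fun i _ => by simp only [ha]; ring
  rw [← sum_mul_siteGenerator_mulVec]
  simp only [hL]
  have e : ∀ v, w v * (ψ v * ∑ i, lam i * a i * b i v) =
      ∑ i, w v * (ψ v * b i v) * (lam i * a i) := by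
    intro v
    rw [Finset.mul_sum, Finset.mul_sum]
    exact Finset.sum_congr rfl fun i _ => by ring
  simp only [e]
  rw [Finset.sum_comm]
  refine Finset.sum_congr rfl fun i _ => ?_
  rw [← Finset.sum_mul]
  simp only [ha]; ring

theorem exists_lam_eq_gap (hb : IsEigenbasis c w lam b) (hc : IsConductance c)
    (hw : IsSiteWeight w) (hgap : 0 < spectralGap c w 1) : ∃ i, lam i = spectralGap c w 1 := by
  by_contra! hne
  -- If no eigenvalue equals the gap, the nonzero ones stay above some larger `r`, and the spectral
  -- expansion yields the Poincaré inequality with constant `r`, contradicting the definition of the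
  -- gap.
  have hr : ∃ r, spectralGap c w 1 < r ∧ ∀ i, lam i ≠ 0 → r ≤ lam i := by
    by_cases hN : (Finset.univ.filter fun i => lam i ≠ 0).Nonempty
    · obtain ⟨i, hi, hmin⟩ := Finset.exists_min_image _ lam hN
      rw [Finset.mem_filter] at hi
      exact ⟨lam i, lt_of_le_of_ne (hb.gap_le hc hw hi.2) (hne i).symm,
        fun j hj => hmin j (Finset.mem_filter.2 ⟨Finset.mem_univ j, hj⟩)⟩
    · exact ⟨_, lt_add_one _, fun i hi =>
        (hN ⟨i, Finset.mem_filter.2 ⟨Finset.mem_univ i, hi⟩⟩).elim⟩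
  obtain ⟨r, hr, hlam⟩ := hr
  refine absurd (le_spectralGap hc hw hgap.ne' (r := r) fun ψ hψ => ?_) (not_le.2 hr)
  have h2 : ∑ v, w v * ψ v ^ 2 = ∑ i, (∑ v, w v * (ψ v * b i v)) ^ 2 := by
    have := hb.sum_mul_eq hw.pos ψ ψ
    simpa only [← sq] using this
  rw [h2, hb.dirichletForm_eq_sum_sq hw.pos, Finset.mul_sum]
  refine Finset.sum_le_sum fun i _ => ?_
  by_cases hi : lam i = 0
  · have hb0 := hb.eq_const hc hw hgap hi
    set m := ∑ u, w u * b i u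
    have : ∑ v, w v * (ψ v * b i v) = 0 := by
      simp only [hb0, ← mul_assoc, ← Finset.sum_mul, hψ, zero_mul]
    rw [this, hi]; simp
  · exact mul_le_mul_of_nonneg_right (hlam i hi) (sq_nonneg _)

end IsEigenbasis

end OneParticle

/-! ### Second moments of the averaging process. -/

section SecondMoment

variable {V : Type*} [Fintype V] [DecidableEq V]

/-- The tensor product of two functions on the sites. -/
def tensor (a b : V → ℝ) : V × V → ℝ := fun p => a p.1 * b p.2

/-- The action of an update on second moments. -/
noncomputable def pairKernel (w : V → ℝ) (x y : V) : Matrix (V × V) (V × V) ℝ :=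
  Matrix.kronecker (edgeKernel w x y) (edgeKernel w x y)

/-- The generator of the evolution of second moments in the averaging process. -/
noncomputable def pairGenerator (c : V → V → ℝ) (w : V → ℝ) : Matrix (V × V) (V × V) ℝ :=
  ∑ e : V × V, (c e.1 e.2 / 2) • (pairKernel w e.1 e.2 - 1)

/-- The second moments at time `t` of the averaging process with initial second moments `q`. -/
noncomputable def secondMoment (c : V → V → ℝ) (w : V → ℝ) (q : V × V → ℝ) (t : ℝ) :
    V × V → ℝ :=
  q ᵥ* NormedSpace.exp (t • pairGenerator c w)

/-- The bilinear form with coefficients `q`. -/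
def pairForm (q : V × V → ℝ) (a b : V → ℝ) : ℝ := q ⬝ᵥ tensor a b

theorem kronecker_mulVec_tensor (A B : Matrix V V ℝ) (a b : V → ℝ) :
    Matrix.kronecker A B *ᵥ tensor a b = tensor (A *ᵥ a) (B *ᵥ b) := by
  ext p
  simp only [Matrix.mulVec, dotProduct, tensor, Finset.sum_mul_sum, Fintype.sum_prod_type]
  refine Finset.sum_congr rfl fun x _ => Finset.sum_congr rfl fun y _ => ?_
  simp only [Matrix.kronecker, Matrix.kroneckerMap_apply]
  ring

theorem tensor_vecMul_kronecker (A B : Matrix V V ℝ) (a b : V → ℝ) :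
    tensor a b ᵥ* Matrix.kronecker A B = tensor (a ᵥ* A) (b ᵥ* B) := by
  ext p
  simp only [Matrix.vecMul, dotProduct, tensor, Finset.sum_mul_sum, Fintype.sum_prod_type]
  refine Finset.sum_congr rfl fun x _ => Finset.sum_congr rfl fun y _ => ?_
  simp only [Matrix.kronecker, Matrix.kroneckerMap_apply]
  ring

theorem tensor_dotProduct_tensor (a b a' b' : V → ℝ) :
    tensor a b ⬝ᵥ tensor a' b' = (a ⬝ᵥ a') * (b ⬝ᵥ b') := by
  simp only [dotProduct, tensor, Finset.sum_mul_sum, Fintype.sum_prod_type]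
  exact Finset.sum_congr rfl fun x _ => Finset.sum_congr rfl fun y _ => by ring

theorem pairForm_tensor (η a b : V → ℝ) : pairForm (tensor η η) a b = (η ⬝ᵥ a) * (η ⬝ᵥ b) :=
  tensor_dotProduct_tensor _ _ _ _

theorem pairForm_sum_left {ι : Type*} [Fintype ι] (q : V × V → ℝ) (r : ι → ℝ) (f : ι → V → ℝ)
    (b : V → ℝ) : pairForm q (∑ i, r i • f i) b = ∑ i, r i * pairForm q (f i) b := by
  simp only [pairForm, dotProduct, tensor, Finset.mul_sum, Finset.sum_apply, Pi.smul_apply,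
    smul_eq_mul, Finset.sum_mul]
  rw [Finset.sum_comm]
  exact Finset.sum_congr rfl fun x _ => Finset.sum_congr rfl fun y _ => by ring

theorem pairForm_sum_right {ι : Type*} [Fintype ι] (q : V × V → ℝ) (r : ι → ℝ) (f : ι → V → ℝ)
    (a : V → ℝ) : pairForm q a (∑ i, r i • f i) = ∑ i, r i * pairForm q a (f i) := by
  simp only [pairForm, dotProduct, tensor, Finset.mul_sum, Finset.sum_apply, Pi.smul_apply,
    smul_eq_mul]
  rw [Finset.sum_comm]
  exact Finset.sum_congr rfl fun x _ => Finset.sum_congr rfl fun y _ => by ring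

theorem pairForm_smul_left (q : V × V → ℝ) (r : ℝ) (a b : V → ℝ) :
    pairForm q (r • a) b = r * pairForm q a b := by
  simp only [pairForm, dotProduct, tensor, Finset.mul_sum, Pi.smul_apply, smul_eq_mul]
  exact Finset.sum_congr rfl fun x _ => by ring

theorem pairForm_smul_right (q : V × V → ℝ) (r : ℝ) (a b : V → ℝ) :
    pairForm q a (r • b) = r * pairForm q a b := by
  simp only [pairForm, dotProduct, tensor, Finset.mul_sum, Pi.smul_apply, smul_eq_mul]
  exact Finset.sum_congr rfl fun x _ => by ring

theorem pairForm_sub_smul (q : V × V → ℝ) (r s : ℝ) (a b v : V → ℝ) :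
    pairForm q (a - r • v) (b - s • v) - pairForm q a b =
      -(r * pairForm q v b) - s * pairForm q a v + r * s * pairForm q v v := by
  simp only [pairForm, dotProduct, tensor, Finset.mul_sum, Pi.smul_apply, Pi.sub_apply, smul_eq_mul,
    ← Finset.sum_sub_distrib, ← Finset.sum_add_distrib, ← Finset.sum_neg_distrib]
  exact Finset.sum_congr rfl fun x _ => by ring

/-- An update changes `a` and `b` by multiples of the same `edgeVec`. The first-order terms
reassemble into the generator acting on each factor; the product of the two increments is the noise.
-/
theorem dotProduct_pairGenerator_mulVec (c : V → V → ℝ) (w : V → ℝ) (q : V × V → ℝ)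
    (a b : V → ℝ) :
    q ⬝ᵥ (pairGenerator c w *ᵥ tensor a b) =
      pairForm q (siteGenerator c w *ᵥ a) b + pairForm q a (siteGenerator c w *ᵥ b) +
        ∑ e : V × V, c e.1 e.2 / 2 * ((a e.1 - a e.2) * (b e.1 - b e.2)) *
          pairForm q (edgeVec w e.1 e.2) (edgeVec w e.1 e.2) := by
  have hneg : ∀ a : V → ℝ, siteGenerator c w *ᵥ a =
      ∑ e : V × V, (-(c e.1 e.2 / 2 * (a e.1 - a e.2))) • edgeVec w e.1 e.2 := by
    intro a
    rw [siteGenerator_mulVec, ← Finset.sum_neg_distrib]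
    exact Finset.sum_congr rfl fun e _ => by rw [neg_smul]
  rw [hneg, hneg, pairForm_sum_left, pairForm_sum_right, ← Finset.sum_add_distrib,
    ← Finset.sum_add_distrib, pairGenerator, Matrix.sum_mulVec, dotProduct_sum]
  refine Finset.sum_congr rfl fun e _ => ?_
  rw [Matrix.smul_mulVec, dotProduct_smul, Matrix.sub_mulVec, Matrix.one_mulVec, dotProduct_sub,
    pairKernel, kronecker_mulVec_tensor, edgeKernel_mulVec, edgeKernel_mulVec]
  have := pairForm_sub_smul q (a e.1 - a e.2) (b e.1 - b e.2) a b (edgeVec w e.1 e.2)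
  simp only [pairForm] at this ⊢
  rw [this, smul_eq_mul]
  ring

theorem hasDerivAt_pairForm (c : V → V → ℝ) (w : V → ℝ) (q : V × V → ℝ) (a b : V → ℝ) (t : ℝ) :
    HasDerivAt (fun s => pairForm (secondMoment c w q s) a b)
      (secondMoment c w q t ⬝ᵥ (pairGenerator c w *ᵥ tensor a b)) t :=
  hasDerivAt_vecMul_exp_dotProduct q (tensor a b) (pairGenerator c w) t

theorem secondMoment_zero (c : V → V → ℝ) (w : V → ℝ) (q : V × V → ℝ) :
    secondMoment c w q 0 = q := by
  simp [secondMoment]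

/-- The rate of decrease of the trace of the second moments. -/
noncomputable def pairEnergy (c : V → V → ℝ) (w : V → ℝ) (q : V × V → ℝ) : ℝ :=
  ∑ e : V × V, c e.1 e.2 / 2 * (1 / w e.1 + 1 / w e.2) *
    pairForm q (edgeVec w e.1 e.2) (edgeVec w e.1 e.2)

/-- The trace of the second moments. -/
noncomputable def pairTrace (w : V → ℝ) (q : V × V → ℝ) : ℝ := ∑ v, q (v, v) / w v

theorem pairTrace_tensor (w η : V → ℝ) : pairTrace w (tensor η η) = ∑ v, η v ^ 2 / w v :=
  Finset.sum_congr rfl fun v _ => by simp only [tensor]; ring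

theorem pairEnergy_tensor {c : V → V → ℝ} {w : V → ℝ} (hw : ∀ v, 0 < w v) (η : V → ℝ) :
    pairEnergy c w (tensor η η) = dirichletForm c w fun v => η v / w v := by
  rw [dirichletForm_eq_sum]
  refine Finset.sum_congr rfl fun e _ => ?_
  rw [pairForm_tensor, dotProduct_edgeVec]
  have := hw e.1; have := hw e.2
  field_simp
  ring

/-- Closed convex constraints satisfied by rank-one second moments persist in time. -/
theorem secondMoment_mem {c : V → V → ℝ} (hc : ∀ x y, 0 ≤ c x y) {w : V → ℝ} (hw : ∀ v, 0 < w v)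
    {D : Set (V × V → ℝ)} (hD : Convex ℝ D) (hDc : IsClosed D)
    (hG : ∀ η, IsProbVec η → tensor η η ∈ D) {η : V → ℝ} (hη : IsProbVec η) {t : ℝ} (ht : 0 ≤ t) :
    secondMoment c w (tensor η η) t ∈ D := by
  have := vecMul_exp_mem (fun e : V × V => c e.1 e.2 / 2)
    (fun e => div_nonneg (hc _ _) zero_le_two) (fun e => pairKernel w e.1 e.2)
    (fun e => pairKernel w e.1 e.2)
    (G := {z | ∃ η, IsProbVec η ∧ z = (tensor η η, tensor η η)}) (D := Prod.snd ⁻¹' D)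
    (z := (tensor η η, tensor η η)) ?_ ?_ (hD.linear_preimage (LinearMap.snd ℝ _ _))
    (hDc.preimage continuous_snd) ⟨η, hη, rfl⟩ ht
  · exact this
  · rintro e - z ⟨η, hη, rfl⟩
    exact ⟨η ᵥ* edgeKernel w e.1 e.2, hη.vecMul_edgeKernel hw _ _, by
      simp only [pairKernel, tensor_vecMul_kronecker]⟩
  · rintro z ⟨η, hη, rfl⟩
    exact hG η hη

theorem continuous_pairForm (a b : V → ℝ) : Continuous fun q : V × V → ℝ => pairForm q a b :=
  continuous_finsetSum _ fun p _ => (continuous_apply p).mul continuous_const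

theorem pairForm_convex_comb (a b : V → ℝ) (q q' : V × V → ℝ) (r s : ℝ) :
    pairForm (r • q + s • q') a b = r * pairForm q a b + s * pairForm q' a b := by
  rw [pairForm, add_dotProduct, smul_dotProduct, smul_dotProduct]; rfl

theorem pairForm_secondMoment_nonneg {c : V → V → ℝ} (hc : ∀ x y, 0 ≤ c x y) {w : V → ℝ}
    (hw : ∀ v, 0 < w v) {η : V → ℝ} (hη : IsProbVec η) {t : ℝ} (ht : 0 ≤ t) (a : V → ℝ) :
    0 ≤ pairForm (secondMoment c w (tensor η η) t) a a := by
  refine secondMoment_mem (D := {q | 0 ≤ pairForm q a a}) hc hw ?_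
    (isClosed_le continuous_const (continuous_pairForm a a)) (fun η _ => ?_) hη ht
  · intro q hq q' hq' r s hr hs _
    rw [Set.mem_ofPred_eq] at *
    rw [pairForm_convex_comb]
    positivity
  · rw [Set.mem_ofPred_eq, pairForm_tensor]
    exact mul_self_nonneg _

theorem pairForm_secondMoment_one {c : V → V → ℝ} (hc : ∀ x y, 0 ≤ c x y) {w : V → ℝ}
    (hw : ∀ v, 0 < w v) {η : V → ℝ} (hη : IsProbVec η) {t : ℝ} (ht : 0 ≤ t) :
    pairForm (secondMoment c w (tensor η η) t) 1 1 = 1 := by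
  refine secondMoment_mem (D := {q | pairForm q 1 1 = 1}) hc hw ?_
    (isClosed_eq (continuous_pairForm 1 1) continuous_const) (fun η hη => ?_) hη ht
  · intro q hq q' hq' r s hr hs hrs
    rw [Set.mem_ofPred_eq] at *
    rw [pairForm_convex_comb, hq, hq', mul_one, mul_one, hrs]
  · rw [Set.mem_ofPred_eq, pairForm_tensor, dotProduct_one, hη.sum_eq_one, one_mul]

namespace IsEigenbasis

variable {c : V → V → ℝ} {w lam : V → ℝ} {b : V → V → ℝ}

theorem sum_sub_sq (hb : IsEigenbasis c w lam b) {x y : V} (hxy : x ≠ y) :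
    ∑ i, (b i x - b i y) ^ 2 = 1 / w x + 1 / w y := by
  have e : ∀ i, (b i x - b i y) ^ 2 = b i x * b i x - 2 * (b i x * b i y) + b i y * b i y := by
    intro i; ring
  simp only [e, Finset.sum_add_distrib, Finset.sum_sub_distrib, ← Finset.mul_sum, hb.complete]
  simp [hxy]

/-- By completeness both sides are the difference of the normalized point masses at `x` and `y`. -/
theorem sum_sub_smul (hb : IsEigenbasis c w lam b) (hw : ∀ v, 0 < w v) (x y : V) :
    ∑ i, (b i x - b i y) • b i = (1 / w x + 1 / w y) • edgeVec w x y := by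
  ext z
  simp only [Finset.sum_apply, Pi.smul_apply, smul_eq_mul, sub_mul, Finset.sum_sub_distrib,
    hb.complete]
  have := hw x; have := hw y
  simp only [edgeVec, Pi.smul_apply, Pi.sub_apply, smul_eq_mul, Pi.single_apply, eq_comm (a := z)]
  split_ifs <;> field_simp <;> ring

theorem sum_pairForm (hb : IsEigenbasis c w lam b) (q : V × V → ℝ) :
    ∑ i, pairForm q (b i) (b i) = pairTrace w q := by
  simp only [pairForm, dotProduct, tensor]
  rw [Finset.sum_comm]
  simp only [← Finset.mul_sum, hb.complete, Fintype.sum_prod_type, pairTrace]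
  refine Finset.sum_congr rfl fun x _ => ?_
  simp [div_eq_mul_inv]

theorem sum_lam_mul_pairForm (hb : IsEigenbasis c w lam b) (hw : ∀ v, 0 < w v)
    (q : V × V → ℝ) : ∑ i, lam i * pairForm q (b i) (b i) = pairEnergy c w q := by
  have h1 : ∀ i, lam i * pairForm q (b i) (b i) = ∑ e : V × V,
      c e.1 e.2 / 2 * (b i e.1 - b i e.2) * pairForm q (b i) (edgeVec w e.1 e.2) := by
    intro i
    rw [← pairForm_smul_right, ← pairForm_sum_right]
    congr 1
    have := hb.eigen i
    rw [siteGenerator_mulVec, neg_smul, neg_inj] at this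
    exact this.symm
  simp only [h1]
  rw [Finset.sum_comm]
  refine Finset.sum_congr rfl fun e _ => ?_
  have := pairForm_sum_left q (fun i => b i e.1 - b i e.2) b (edgeVec w e.1 e.2)
  rw [hb.sum_sub_smul hw, pairForm_smul_left] at this
  rw [mul_assoc, this, Finset.mul_sum]
  exact Finset.sum_congr rfl fun i _ => by ring

theorem deriv_mode (hb : IsEigenbasis c w lam b) (q : V × V → ℝ) (i : V) :
    q ⬝ᵥ (pairGenerator c w *ᵥ tensor (b i) (b i)) =
      -2 * (lam i * pairForm q (b i) (b i)) + ∑ e : V × V, c e.1 e.2 / 2 *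
        (b i e.1 - b i e.2) ^ 2 * pairForm q (edgeVec w e.1 e.2) (edgeVec w e.1 e.2) := by
  rw [dotProduct_pairGenerator_mulVec, hb.eigen, pairForm_smul_left, pairForm_smul_right]
  simp only [← sq]
  ring

theorem deriv_sum_modes (hb : IsEigenbasis c w lam b) (q : V × V → ℝ) (s : Finset V) :
    ∑ i ∈ s, q ⬝ᵥ (pairGenerator c w *ᵥ tensor (b i) (b i)) =
      -2 * ∑ i ∈ s, lam i * pairForm q (b i) (b i) + ∑ e : V × V, c e.1 e.2 / 2 *
        (∑ i ∈ s, (b i e.1 - b i e.2) ^ 2) *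
          pairForm q (edgeVec w e.1 e.2) (edgeVec w e.1 e.2) := by
  simp only [hb.deriv_mode, Finset.sum_add_distrib, ← Finset.mul_sum]
  congr 1
  rw [Finset.sum_comm]
  refine Finset.sum_congr rfl fun e _ => ?_
  rw [Finset.mul_sum, Finset.sum_mul]

/-- Modes whose increments over edges are small compared with those of the full basis receive only
the fraction `ε` of the total noise `pairEnergy`. -/
theorem deriv_sum_modes_le (hb : IsEigenbasis c w lam b) (hc : IsConductance c)
    {q : V × V → ℝ} (hq : ∀ a, 0 ≤ pairForm q a a) {s : Finset V} {ε : ℝ}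
    (hε : ∀ x y, x ≠ y → ∑ i ∈ s, (b i x - b i y) ^ 2 ≤ ε * (1 / w x + 1 / w y)) :
    ∑ i ∈ s, q ⬝ᵥ (pairGenerator c w *ᵥ tensor (b i) (b i)) ≤
      -2 * ∑ i ∈ s, lam i * pairForm q (b i) (b i) + ε * pairEnergy c w q := by
  rw [hb.deriv_sum_modes, pairEnergy, Finset.mul_sum _ _ ε]
  refine add_le_add le_rfl (Finset.sum_le_sum fun e _ => ?_)
  rcases eq_or_ne e.1 e.2 with h | h
  · rw [h, hc.diag]; simp
  · have h1 := mul_le_mul_of_nonneg_left (hε _ _ h)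
      (div_nonneg (hc.nonneg e.1 e.2) zero_le_two)
    have h2 := mul_le_mul_of_nonneg_right h1 (hq (edgeVec w e.1 e.2))
    linarith

/-- Over all modes the dissipation is twice the energy, and by `sum_sub_sq` the noise is exactly the
energy. -/
theorem hasDerivAt_pairTrace (hb : IsEigenbasis c w lam b) (hc : IsConductance c)
    (hw : ∀ v, 0 < w v) (q : V × V → ℝ) (t : ℝ) :
    HasDerivAt (fun s => pairTrace w (secondMoment c w q s))
      (-pairEnergy c w (secondMoment c w q t)) t := by
  have h1 := HasDerivAt.fun_sum (u := Finset.univ)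
    fun i _ => hasDerivAt_pairForm c w q (b i) (b i) t
  simp only [hb.sum_pairForm] at h1
  convert! h1 using 1
  rw [hb.deriv_sum_modes, hb.sum_lam_mul_pairForm hw]
  have : ∑ e : V × V, c e.1 e.2 / 2 * (∑ i, (b i e.1 - b i e.2) ^ 2) *
      pairForm (secondMoment c w q t) (edgeVec w e.1 e.2) (edgeVec w e.1 e.2) =
      pairEnergy c w (secondMoment c w q t) := by
    refine Finset.sum_congr rfl fun e _ => ?_
    rcases eq_or_ne e.1 e.2 with h | h
    · rw [h, hc.diag]; simp
    · rw [hb.sum_sub_sq h]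
  rw [this]; ring

end IsEigenbasis

end SecondMoment

/-! ### Slow and fast modes, and their decay. -/

section Modes

variable {V : Type*} [Fintype V] [DecidableEq V]

/-- The non-constant modes with decay rate below `4 θ`. -/
noncomputable def lowModes (lam : V → ℝ) (θ : ℝ) : Finset V :=
  Finset.univ.filter fun i => lam i ≠ 0 ∧ lam i < 4 * θ

/-- The modes with decay rate at least `4 θ`. -/
noncomputable def highModes (lam : V → ℝ) (θ : ℝ) : Finset V :=
  Finset.univ.filter fun i => 4 * θ ≤ lam i

/-- The mass which the second moments `q` give to a set of modes. -/
def modeMass (b : V → V → ℝ) (s : Finset V) (q : V × V → ℝ) : ℝ := ∑ i ∈ s, pairForm q (b i) (b i)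

variable {c : V → V → ℝ} {w lam : V → ℝ} {b : V → V → ℝ}

theorem modeMass_nonneg {q : V × V → ℝ} (hq : ∀ a, 0 ≤ pairForm q a a) (s : Finset V) :
    0 ≤ modeMass b s q :=
  Finset.sum_nonneg fun i _ => hq (b i)

theorem sum_eq_zero_add_low_add_high {θ : ℝ} (hθ : 0 < θ) (f : V → ℝ) :
    ∑ i, f i = ∑ i ∈ Finset.univ.filter (fun i => lam i = 0), f i + ∑ i ∈ lowModes lam θ, f i +
      ∑ i ∈ highModes lam θ, f i := by
  rw [lowModes, highModes, Finset.sum_filter, Finset.sum_filter, Finset.sum_filter,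
    ← Finset.sum_add_distrib, ← Finset.sum_add_distrib]
  refine Finset.sum_congr rfl fun i _ => ?_
  by_cases h0 : lam i = 0
  · have : ¬4 * θ ≤ 0 := by linarith
    simp [h0, this]
  · by_cases h1 : lam i < 4 * θ
    · simp [h0, h1, not_le.2 h1]
    · simp [h0, h1, not_lt.1 h1]

namespace IsEigenbasis

theorem pairTrace_bounds (hb : IsEigenbasis c w lam b) (hc : IsConductance c)
    (hw : IsSiteWeight w) (hgap : 0 < spectralGap c w 1) {q : V × V → ℝ}
    (hq : ∀ a, 0 ≤ pairForm q a a) (hq1 : pairForm q 1 1 = 1) {θ : ℝ} (hθ : 0 < θ) :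
    pairTrace w q - 1 ≤ modeMass b (lowModes lam θ) q + modeMass b (highModes lam θ) q ∧
      modeMass b (lowModes lam θ) q + modeMass b (highModes lam θ) q ≤ pairTrace w q := by
  have h := sum_eq_zero_add_low_add_high (lam := lam) hθ fun i => pairForm q (b i) (b i)
  rw [hb.sum_pairForm] at h
  have h0 : 0 ≤ ∑ i ∈ Finset.univ.filter (fun i => lam i = 0), pairForm q (b i) (b i) :=
    Finset.sum_nonneg fun i _ => hq (b i)
  -- There is at most one mode with eigenvalue zero; it is a normalized constant and carries the
  -- conserved total mass.
  have h1 : ∑ i ∈ Finset.univ.filter (fun i => lam i = 0), pairForm q (b i) (b i) ≤ 1 := by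
    have hcard : (Finset.univ.filter fun i => lam i = 0).card ≤ 1 :=
      Finset.card_le_one.2 fun i hi j hj =>
        hb.eq_of_lam_eq_zero hc hw hgap (Finset.mem_filter.1 hi).2 (Finset.mem_filter.1 hj).2
    have hone : ∀ i ∈ Finset.univ.filter (fun i => lam i = 0), pairForm q (b i) (b i) ≤ 1 := by
      intro i hi
      have e := hb.eq_const hc hw hgap (Finset.mem_filter.1 hi).2
      have e2 := hb.sum_sq i
      set m := ∑ u, w u * b i u
      have e3 : b i = m • (1 : V → ℝ) := by ext v; simp [e v]
      simp only [e, ← Finset.sum_mul, hw.sum_eq_one, one_mul] at e2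
      rw [e3, pairForm_smul_left, pairForm_smul_right, hq1, mul_one, ← sq, e2]
    refine (Finset.sum_le_card_nsmul _ _ 1 hone).trans ?_
    simpa using hcard
  simp only [modeMass]
  constructor <;> linarith

theorem hasDerivAt_modeMass (c : V → V → ℝ) (w : V → ℝ) (b : V → V → ℝ) (s : Finset V)
    (q : V × V → ℝ) (t : ℝ) :
    HasDerivAt (fun u => modeMass b s (secondMoment c w q u))
      (∑ i ∈ s, secondMoment c w q t ⬝ᵥ (pairGenerator c w *ᵥ tensor (b i) (b i))) t :=
  HasDerivAt.fun_sum fun i _ => hasDerivAt_pairForm c w q (b i) (b i) t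

/-- Decay of the second moments, given that the slow modes are spread out. -/
theorem modeMass_decay (hb : IsEigenbasis c w lam b) (hc : IsConductance c) (hw : IsSiteWeight w)
    (hgap : 0 < spectralGap c w 1) {ε : ℝ} (hε0 : 0 ≤ ε) (hε3 : ε ≤ 1 / 3)
    (hε : ∀ x y, x ≠ y → ∑ i ∈ lowModes lam (spectralGap c w 1), (b i x - b i y) ^ 2 ≤
      ε * (1 / w x + 1 / w y)) {η : V → ℝ} (hη : IsProbVec η) {s : ℝ} (hs : 0 ≤ s) {t : ℝ}
    (ht : 0 ≤ t) :
    modeMass b (lowModes lam (spectralGap c w 1)) (secondMoment c w (tensor η η) (s + t)) ≤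
        Real.exp (-((2 - 3 * ε) * spectralGap c w 1) * t) *
          (modeMass b (lowModes lam (spectralGap c w 1)) (secondMoment c w (tensor η η) s) +
            2 * ε * modeMass b (highModes lam (spectralGap c w 1))
              (secondMoment c w (tensor η η) s)) ∧
      modeMass b (lowModes lam (spectralGap c w 1)) (secondMoment c w (tensor η η) (s + t)) +
          modeMass b (highModes lam (spectralGap c w 1)) (secondMoment c w (tensor η η) (s + t)) ≤
        4 * (modeMass b (lowModes lam (spectralGap c w 1)) (secondMoment c w (tensor η η) s) +
            modeMass b (highModes lam (spectralGap c w 1)) (secondMoment c w (tensor η η) s)) *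
          Real.exp (-((2 - 3 * ε) * spectralGap c w 1) * t) := by
  set θ := spectralGap c w 1 with hθ
  set q : ℝ → V × V → ℝ := fun u => secondMoment c w (tensor η η) u with hqdef
  set Lo := lowModes lam θ with hLo
  set Hi := highModes lam θ with hHi
  have hq : ∀ u, 0 ≤ u → ∀ a, 0 ≤ pairForm (q u) a a := fun u hu a =>
    pairForm_secondMoment_nonneg hc.nonneg hw.pos hη hu a
  have hE : ∀ u, pairEnergy c w (q u) =
      ∑ i ∈ Lo, lam i * pairForm (q u) (b i) (b i) +
        ∑ i ∈ Hi, lam i * pairForm (q u) (b i) (b i) := by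
    intro u
    rw [← hb.sum_lam_mul_pairForm hw.pos,
      sum_eq_zero_add_low_add_high (lam := lam) hgap fun i => lam i * pairForm (q u) (b i) (b i)]
    have : ∑ i ∈ Finset.univ.filter (fun i => lam i = 0), lam i * pairForm (q u) (b i) (b i) = 0 :=
      Finset.sum_eq_zero fun i hi => by rw [(Finset.mem_filter.1 hi).2, zero_mul]
    rw [this, zero_add]
  have hmemL : ∀ i ∈ Lo, θ ≤ lam i ∧ lam i ≤ 4 * θ := fun i hi => by
    have := (Finset.mem_filter.1 hi).2
    exact ⟨hb.gap_le hc hw this.1, this.2.le⟩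
  have hmemH : ∀ i ∈ Hi, 4 * θ ≤ lam i := fun i hi => (Finset.mem_filter.1 hi).2
  have key := two_scale_decay (θ := θ) (ε := ε) hgap hε0 hε3
    (l := fun u => modeMass b Lo (q (s + u))) (h := fun u => modeMass b Hi (q (s + u)))
    (l' := fun u => ∑ i ∈ Lo, q (s + u) ⬝ᵥ (pairGenerator c w *ᵥ tensor (b i) (b i)))
    (h' := fun u => ∑ i ∈ Hi, q (s + u) ⬝ᵥ (pairGenerator c w *ᵥ tensor (b i) (b i)))
    (gl := fun u => ∑ i ∈ Lo, lam i * pairForm (q (s + u)) (b i) (b i))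
    (gh := fun u => ∑ i ∈ Hi, lam i * pairForm (q (s + u)) (b i) (b i))
    (fun u _ => (hasDerivAt_modeMass c w b Lo (tensor η η) (s + u)).comp_const_add s u)
    (fun u _ => (hasDerivAt_modeMass c w b Hi (tensor η η) (s + u)).comp_const_add s u)
    (fun u hu => by
      have := hb.deriv_sum_modes_le hc (hq (s + u) (by linarith)) hε
      rwa [hE] at this)
    (fun u hu => by
      -- For the fast modes the trivial fraction 1 of the noise suffices: their dissipation still
      -- exceeds it by `gh - gl`.
      have h1 : ∀ x y, x ≠ y → ∑ i ∈ Hi, (b i x - b i y) ^ 2 ≤ 1 * (1 / w x + 1 / w y) := by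
        intro x y hxy
        rw [one_mul, ← hb.sum_sub_sq hxy]
        exact Finset.sum_le_univ_sum_of_nonneg fun i => sq_nonneg _
      have := hb.deriv_sum_modes_le hc (hq (s + u) (by linarith)) h1
      rw [hE] at this
      linarith)
    (fun u hu => by
      rw [modeMass, Finset.mul_sum]
      exact Finset.sum_le_sum fun i hi => mul_le_mul_of_nonneg_right (hmemL i hi).1
        (hq (s + u) (by linarith) _))
    (fun u hu => by
      rw [modeMass, Finset.mul_sum]
      exact Finset.sum_le_sum fun i hi => mul_le_mul_of_nonneg_right (hmemL i hi).2
        (hq (s + u) (by linarith) _))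
    (fun u hu => by
      rw [modeMass, Finset.mul_sum]
      exact Finset.sum_le_sum fun i hi => mul_le_mul_of_nonneg_right (hmemH i hi)
        (hq (s + u) (by linarith) _))
    (fun u hu => modeMass_nonneg (hq (s + u) (by linarith)) _)
    (fun u hu => modeMass_nonneg (hq (s + u) (by linarith)) _) ht
  simpa only [add_zero] using key

/-- A lower bound for the second moment of a single mode. -/
theorem exp_mul_sq_le_pairForm (hb : IsEigenbasis c w lam b) (hc : IsConductance c)
    (hw : IsSiteWeight w) (x i : V) {t : ℝ} (ht : 0 ≤ t) :
    Real.exp (-(2 * lam i) * t) * b i x ^ 2 ≤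
      pairForm (secondMoment c w (tensor (Pi.single x 1) (Pi.single x 1)) t) (b i) (b i) := by
  have hq : ∀ u, 0 ≤ u → ∀ a, 0 ≤
      pairForm (secondMoment c w (tensor (Pi.single x 1) (Pi.single x 1)) u) a a := fun u hu a =>
    pairForm_secondMoment_nonneg hc.nonneg hw.pos (IsProbVec.single x) hu a
  have := exp_le_of_le_deriv (r := 2 * lam i)
    (fun u _ => hasDerivAt_pairForm c w (tensor (Pi.single x 1) (Pi.single x 1)) (b i) (b i) u)
    (fun u hu => by
      rw [hb.deriv_mode]
      have : 0 ≤ ∑ e : V × V, c e.1 e.2 / 2 * (b i e.1 - b i e.2) ^ 2 *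
          pairForm (secondMoment c w (tensor (Pi.single x 1) (Pi.single x 1)) u)
            (edgeVec w e.1 e.2) (edgeVec w e.1 e.2) :=
        Finset.sum_nonneg fun e _ => mul_nonneg (mul_nonneg
          (div_nonneg (hc.nonneg _ _) zero_le_two) (sq_nonneg _)) (hq u hu _)
      linarith) ht
  rwa [secondMoment_zero, pairForm_tensor, single_one_dotProduct, ← sq] at this

/-- Started from a point mass at `x`, mode `i` has second moment `b i x ^ 2`. A slow mode decays at
rate below `2 * (4 * θ)` even without noise, so at time `t` the trace still sees its initial value
up to `exp (8 θ t)`. -/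
theorem sum_lowModes_sq_le (hb : IsEigenbasis c w lam b) (hc : IsConductance c)
    (hw : IsSiteWeight w) {θ : ℝ} (x : V) {t : ℝ} (ht : 0 ≤ t) :
    ∑ i ∈ lowModes lam θ, b i x ^ 2 ≤ Real.exp (8 * (θ * t)) *
      pairTrace w (secondMoment c w (tensor (Pi.single x 1) (Pi.single x 1)) t) := by
  have hq : ∀ a, 0 ≤
      pairForm (secondMoment c w (tensor (Pi.single x 1) (Pi.single x 1)) t) a a := fun a =>
    pairForm_secondMoment_nonneg hc.nonneg hw.pos (IsProbVec.single x) ht a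
  rw [← hb.sum_pairForm, Finset.mul_sum]
  refine le_trans (Finset.sum_le_sum fun i hi => ?_) (Finset.sum_le_univ_sum_of_nonneg fun i =>
    mul_nonneg (Real.exp_pos _).le (hq (b i)))
  have h1 := hb.exp_mul_sq_le_pairForm hc hw x i ht
  have h2 : (1 : ℝ) ≤ Real.exp (8 * (θ * t)) * Real.exp (-(2 * lam i) * t) := by
    rw [← Real.exp_add]
    refine Real.one_le_exp ?_
    have := mul_le_mul_of_nonneg_right (Finset.mem_filter.1 hi).2.2.le ht
    linarith
  have h3 := mul_le_mul_of_nonneg_left h1 (Real.exp_pos (8 * (θ * t))).le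
  have h4 := mul_le_mul_of_nonneg_right h2 (sq_nonneg (b i x))
  linarith

/-- Bounded slow modes have edge increments of order one, whereas `1 / w x + 1 / w y` is of order
`N`; this is the source of the small fraction ε. -/
theorem sum_lowModes_sub_sq_le {θ B N cell : ℝ} (hw : ∀ v, 0 < w v) (hN : 0 < N)
    (hcell : 0 < cell) (hwN : ∀ v, w v ≤ cell / N)
    (hB : ∀ x, ∑ i ∈ lowModes lam θ, b i x ^ 2 ≤ B ^ 2) (x y : V) :
    ∑ i ∈ lowModes lam θ, (b i x - b i y) ^ 2 ≤
      2 * B ^ 2 * cell / N * (1 / w x + 1 / w y) := by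
  have h1 : ∑ i ∈ lowModes lam θ, (b i x - b i y) ^ 2 ≤
      ∑ i ∈ lowModes lam θ, (2 * b i x ^ 2 + 2 * b i y ^ 2) :=
    Finset.sum_le_sum fun i _ => by nlinarith [sq_nonneg (b i x + b i y)]
  rw [Finset.sum_add_distrib, ← Finset.mul_sum, ← Finset.mul_sum] at h1
  have h2 : ∀ v, N / cell ≤ 1 / w v := fun v => by
    rw [div_le_div_iff₀ hcell (hw v)]
    have := (le_div_iff₀ hN).1 (hwN v)
    linarith
  have h3 : 2 * B ^ 2 * cell / N * (N / cell + N / cell) ≤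
      2 * B ^ 2 * cell / N * (1 / w x + 1 / w y) :=
    mul_le_mul_of_nonneg_left (add_le_add (h2 x) (h2 y)) (by positivity)
  have h4 : 2 * B ^ 2 * cell / N * (N / cell + N / cell) = 4 * B ^ 2 := by field_simp; ring
  linarith [hB x, hB y]

end IsEigenbasis

end Modes

/-! ### The Nash inequality for the averaging process. -/

section Nash

variable {V : Type*} [Fintype V] [DecidableEq V] {c : V → V → ℝ} {w : V → ℝ}

theorem pairTrace_convex_comb (w : V → ℝ) (q q' : V × V → ℝ) (r s : ℝ) :
    pairTrace w (r • q + s • q') = r * pairTrace w q + s * pairTrace w q' := by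
  simp only [pairTrace, Finset.mul_sum, ← Finset.sum_add_distrib, Pi.add_apply, Pi.smul_apply,
    smul_eq_mul]
  exact Finset.sum_congr rfl fun v _ => by ring

theorem pairEnergy_convex_comb (c : V → V → ℝ) (w : V → ℝ) (q q' : V × V → ℝ) (r s : ℝ) :
    pairEnergy c w (r • q + s • q') = r * pairEnergy c w q + s * pairEnergy c w q' := by
  simp only [pairEnergy, Finset.mul_sum, ← Finset.sum_add_distrib, pairForm_convex_comb]
  exact Finset.sum_congr rfl fun v _ => by ring

theorem continuous_pairTrace (w : V → ℝ) : Continuous (pairTrace w) :=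
  continuous_finsetSum _ fun v _ => (continuous_apply (v, v)).div_const _

theorem continuous_pairEnergy (c : V → V → ℝ) (w : V → ℝ) : Continuous (pairEnergy c w) :=
  continuous_finsetSum _ fun _ _ => continuous_const.mul (continuous_pairForm _ _)

/-- The Nash inequality for densities of probability vectors. -/
theorem NashInequality.le_dirichletForm (hw : IsSiteWeight w) {d tN T D : ℝ} (hd : 0 < d)
    (hdD : d ≤ D) (hN : 0 < tN) (h : NashInequality c w d tN T) {η : V → ℝ} (hη : IsProbVec η) :
    (∑ v, η v ^ 2 / w v) ^ (1 + 2 / D) / tN ≤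
      dirichletForm c w (fun v => η v / w v) + (∑ v, η v ^ 2 / w v) / T := by
  set F := ∑ v, η v ^ 2 / w v with hF
  have hF1 : 1 ≤ F := one_le_sum_sq_div hw hη
  have hs2 : siteNorm w 2 (fun v => η v / w v) = F ^ (1 / 2 : ℝ) := by
    rw [siteNorm, hF]
    congr 1
    refine Finset.sum_congr rfl fun v _ => ?_
    have := (hw.pos v).ne'
    rw [Real.rpow_two, sq_abs]
    field_simp
  have hs1 : siteNorm w 1 (fun v => η v / w v) = 1 := by
    rw [siteNorm]
    have : ∑ v, w v * |η v / w v| ^ (1 : ℝ) = 1 := by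
      refine (Finset.sum_congr rfl fun v _ => ?_).trans hη.sum_eq_one
      have := (hw.pos v).ne'
      rw [Real.rpow_one, abs_of_nonneg (div_nonneg (hη.nonneg v) (hw.pos v).le)]
      field_simp
    rw [this, Real.one_rpow]
  have h1 := h fun v => η v / w v
  have hF0 : 0 ≤ F := by linarith
  rw [hs1, hs2, Real.one_rpow, mul_one, ← Real.rpow_natCast (F ^ (1 / 2 : ℝ)) 2,
    ← Real.rpow_mul hF0, ← Real.rpow_mul hF0] at h1
  have e1 : (1 / 2 : ℝ) * (2 * (1 + 2 / d)) = 1 + 2 / d := by ring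
  have e2 : (1 / 2 : ℝ) * ((2 : ℕ) : ℝ) = 1 := by norm_num
  rw [e1, e2, Real.rpow_one] at h1
  rw [div_le_iff₀ hN]
  -- Since `1 ≤ F`, the dimension may be replaced by its upper bound, which gives an exponent
  -- uniform in n.
  have h2 : F ^ (1 + 2 / D) ≤ F ^ (1 + 2 / d) :=
    Real.rpow_le_rpow_of_exponent_le hF1
      (add_le_add le_rfl (div_le_div_of_nonneg_left zero_le_two hd hdD))
  refine (h2.trans h1).trans_eq ?_
  ring

/-- For rank-one second moments this is the Nash inequality of the density `η / w`. It passes to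
mixtures because the right side is linear and `x ^ (1 + 2 / D)` is convex. -/
theorem pairTrace_secondMoment_nash (hc : IsConductance c) (hw : IsSiteWeight w) {d tN T D : ℝ}
    (hd : 0 < d) (hdD : d ≤ D) (hN : 0 < tN) (h : NashInequality c w d tN T) {η : V → ℝ}
    (hη : IsProbVec η) {t : ℝ} (ht : 0 ≤ t) :
    1 ≤ pairTrace w (secondMoment c w (tensor η η) t) ∧
      pairTrace w (secondMoment c w (tensor η η) t) ^ (1 + 2 / D) / tN ≤
        pairEnergy c w (secondMoment c w (tensor η η) t) +
          pairTrace w (secondMoment c w (tensor η η) t) / T := by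
  have hD : 0 < D := hd.trans_le hdD
  have hp : 1 ≤ 1 + 2 / D := by
    have : 0 < 2 / D := by positivity
    linarith
  refine secondMoment_mem (D := {q | 1 ≤ pairTrace w q} ∩ {q | pairTrace w q ^ (1 + 2 / D) / tN ≤
    pairEnergy c w q + pairTrace w q / T}) hc.nonneg hw.pos ?_ ?_ (fun η hη => ?_) hη ht
  · rintro q ⟨hq1, hq2⟩ q' ⟨hq1', hq2'⟩ r s hr hs hrs
    rw [Set.mem_ofPred_eq] at hq1 hq2 hq1' hq2'
    refine ⟨?_, ?_⟩ <;> rw [Set.mem_ofPred_eq]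
    · rw [pairTrace_convex_comb]
      have := mul_le_mul_of_nonneg_left hq1 hr
      have := mul_le_mul_of_nonneg_left hq1' hs
      linarith
    · rw [pairTrace_convex_comb, pairEnergy_convex_comb]
      have h1 := (convexOn_rpow hp).2 (x := pairTrace w q) (y := pairTrace w q')
        (zero_le_one.trans hq1) (zero_le_one.trans hq1') hr hs hrs
      simp only [smul_eq_mul] at h1
      have h2 := div_le_div_of_nonneg_right h1 hN.le
      have h3 := mul_le_mul_of_nonneg_left hq2 hr
      have h4 := mul_le_mul_of_nonneg_left hq2' hs
      refine h2.trans ?_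
      have e1 : (r * pairTrace w q ^ (1 + 2 / D) + s * pairTrace w q' ^ (1 + 2 / D)) / tN =
        r * (pairTrace w q ^ (1 + 2 / D) / tN) + s * (pairTrace w q' ^ (1 + 2 / D) / tN) := by ring
      have e2 : (r * pairTrace w q + s * pairTrace w q') / T =
        r * (pairTrace w q / T) + s * (pairTrace w q' / T) := by ring
      rw [e1, e2]
      linarith
  · refine (isClosed_le continuous_const (continuous_pairTrace w)).inter (isClosed_le ?_ ?_)
    · exact ((continuous_pairTrace w).rpow_const fun _ => Or.inr (by linarith)).div_const _
    · exact (continuous_pairEnergy c w).add ((continuous_pairTrace w).div_const _)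
  · refine ⟨?_, ?_⟩ <;> rw [Set.mem_ofPred_eq]
    · rw [pairTrace_tensor]; exact one_le_sum_sq_div hw hη
    · rw [pairTrace_tensor, pairEnergy_tensor hw.pos]
      exact h.le_dirichletForm hw hd hdD hN hη

/-- The second moments are of order one after the time which the Nash inequality provides. -/
theorem pairTrace_secondMoment_le (hc : IsConductance c) (hw : IsSiteWeight w) {d tN T D K : ℝ}
    (hd : 0 < d) (hdD : d ≤ D) (hN : 0 < tN) (hT : 0 < T) (hK : tN ≤ K * T)
    (h : NashInequality c w d tN T) {η : V → ℝ} (hη : IsProbVec η) :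
    pairTrace w (secondMoment c w (tensor η η) T) ≤
      (K * Real.exp (2 / D) / (Real.exp (2 / D) - 1)) ^ (1 / (2 / D)) := by
  obtain ⟨lam, b, hb⟩ := exists_isEigenbasis c hw.pos
  refine nash_differential_bound (div_pos zero_lt_two (hd.trans_le hdD)) hN hT hK
    (F := fun s => pairTrace w (secondMoment c w (tensor η η) s))
    (fun t _ => hb.hasDerivAt_pairTrace hc hw.pos (tensor η η) t)
    (fun t ht => (pairTrace_secondMoment_nash hc hw hd hdD hN h hη ht).1) (fun t ht => ?_)
  have := (pairTrace_secondMoment_nash hc hw hd hdD hN h hη ht).2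
  linarith

end Nash

/-! ### Upper bound on the distance to equilibrium. -/

section UpperBound

variable {V : Type*} [Fintype V] [DecidableEq V] {c : V → V → ℝ} {w : V → ℝ} {k : ℕ}

theorem worstTV_nonneg (c : V → V → ℝ) (w : V → ℝ) (k : ℕ) (t : ℝ) : 0 ≤ worstTV c w k t :=
  Real.iSup_nonneg fun _ => tvDist_nonneg _ _

theorem sum_convex_comb (A : Finset (Config V k)) (p p' : Config V k → ℝ) (r s : ℝ) :
    ∑ ζ ∈ A, (r • p + s • p') ζ = r * ∑ ζ ∈ A, p ζ + s * ∑ ζ ∈ A, p' ζ := by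
  simp only [Finset.mul_sum, ← Finset.sum_add_distrib, Pi.add_apply, Pi.smul_apply, smul_eq_mul]

/-- Bounds of the discrepancy from equilibrium by the second moments of independent particles
persist in time. -/
theorem productLaw_semigroup_sub_sq_le (hc : IsConductance c) (hw : IsSiteWeight w) {ι : Type*}
    [Fintype ι] [DecidableEq ι] (hι : Fintype.card ι = k) (A : Finset (Config V k)) (α β : ℝ)
    (h : ∀ η : ι → V → ℝ, (∀ i, IsProbVec (η i)) →
      (∑ ζ ∈ A, productLaw hι η ζ - ∑ ζ ∈ A, multinomial w k ζ) ^ 2 ≤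
        α * pairTrace w (∑ i, tensor (η i) (η i)) + β)
    {η : ι → V → ℝ} (hη : ∀ i, IsProbVec (η i)) {t : ℝ} (ht : 0 ≤ t) :
    (∑ ζ ∈ A, (productLaw hι η ᵥ* semigroup c w k t) ζ - ∑ ζ ∈ A, multinomial w k ζ) ^ 2 ≤
      α * pairTrace w (secondMoment c w (∑ i, tensor (η i) (η i)) t) + β := by
  rw [semigroup, generator_eq_sum]
  have := vecMul_exp_mem (fun e : V × V => c e.1 e.2 / 2)
    (fun e => div_nonneg (hc.nonneg _ _) zero_le_two) (fun e => splitMatrix w k e.1 e.2)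
    (fun e => pairKernel w e.1 e.2)
    (G := {z | ∃ η : ι → V → ℝ, (∀ i, IsProbVec (η i)) ∧
      z = (productLaw hι η, ∑ i, tensor (η i) (η i))})
    (D := {z | (∑ ζ ∈ A, z.1 ζ - ∑ ζ ∈ A, multinomial w k ζ) ^ 2 ≤ α * pairTrace w z.2 + β})
    (z := (productLaw hι η, ∑ i, tensor (η i) (η i))) ?_ ?_ ?_ ?_ ⟨η, hη, rfl⟩ ht
  · exact this
  · rintro e he z ⟨η, hη, rfl⟩
    refine ⟨fun i => η i ᵥ* edgeKernel w e.1 e.2,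
      fun i => (hη i).vecMul_edgeKernel hw.pos _ _, ?_⟩
    -- On the diagonal `splitMatrix` is in general not stochastic, but there the rate vanishes.
    have hne : e.1 ≠ e.2 := fun h => he (by rw [h, hc.diag, zero_div])
    simp only [productLaw_vecMul_splitMatrix hι hw.pos hne, Matrix.sum_vecMul, pairKernel,
      tensor_vecMul_kronecker]
  · rintro z ⟨η, hη, rfl⟩
    exact h η hη
  · rintro z hz z' hz' r s hr hs hrs
    rw [Set.mem_ofPred_eq] at *
    rw [Prod.fst_add, Prod.snd_add, Prod.smul_fst, Prod.smul_snd, Prod.smul_fst, Prod.smul_snd,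
      pairTrace_convex_comb, sum_convex_comb]
    generalize ∑ ζ ∈ A, z.1 ζ = x at *
    generalize ∑ ζ ∈ A, z'.1 ζ = x' at *
    generalize ∑ ζ ∈ A, multinomial w k ζ = m at *
    have h1 := mul_le_mul_of_nonneg_left hz hr
    have h2 := mul_le_mul_of_nonneg_left hz' hs
    -- The convexity defect of the square, using `r + s = 1`.
    have h3 : r * (x - m) ^ 2 + s * (x' - m) ^ 2 - (r * x + s * x' - m) ^ 2 =
        r * s * (x - x') ^ 2 := by
      rw [← sub_eq_of_eq_add' hrs.symm]; ring
    have h4 : 0 ≤ r * s * (x - x') ^ 2 := by positivity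
    have h5 : β = (r + s) * β := by rw [hrs, one_mul]
    linarith
  · refine isClosed_le ?_ ?_
    · exact ((continuous_finsetSum _ fun ζ _ => (continuous_apply ζ).comp continuous_fst).sub
        continuous_const).pow 2
    · exact (continuous_const.mul ((continuous_pairTrace w).comp continuous_snd)).add
        continuous_const

theorem pairTrace_sum {ι : Type*} [Fintype ι] (w : V → ℝ) (q : ι → V × V → ℝ) :
    pairTrace w (∑ i, q i) = ∑ i, pairTrace w (q i) := by
  simp only [pairTrace, Finset.sum_apply, Finset.sum_div]
  rw [Finset.sum_comm]

theorem worstTV_le_one (hc : IsConductance c) (hw : IsSiteWeight w) {t : ℝ} (ht : 0 ≤ t) :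
    worstTV c w k t ≤ 1 := by
  refine Real.iSup_le (fun ξ => ?_) zero_le_one
  refine Real.iSup_le (fun A => (sq_le_one_iff_abs_le_one _).1 ?_) zero_le_one
  obtain ⟨hι, hξ⟩ := exists_countConfig_eq ξ
  have h := productLaw_semigroup_sub_sq_le hc hw hι A 0 1
    (fun η hη => by simpa using productLaw_sub_multinomial_sq_le_one hι hw hη A)
    (η := fun i => Pi.single i.1 1) (fun i => IsProbVec.single i.1) ht
  rw [productLaw_single, hξ] at h
  simpa using h

theorem worstTV_le_of_pairTrace_le (hc : IsConductance c) (hw : IsSiteWeight w) {t M : ℝ}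
    (ht : 0 ≤ t) (hM : ∀ x, pairTrace w
      (secondMoment c w (tensor (Pi.single x 1) (Pi.single x 1)) t) - 1 ≤ M) :
    worstTV c w k t ≤ √(2 * (k * M)) := by
  refine Real.iSup_le (fun ξ => ?_) (Real.sqrt_nonneg _)
  refine Real.iSup_le (fun A => Real.abs_le_sqrt ?_) (Real.sqrt_nonneg _)
  obtain ⟨hι, hξ⟩ := exists_countConfig_eq ξ
  have h := productLaw_semigroup_sub_sq_le hc hw hι A 2 (-(2 * k))
    (fun η hη => by
      refine (productLaw_sub_multinomial_sq_le hι hw hη A).trans_eq ?_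
      rw [Finset.sum_sub_distrib, pairTrace_sum]
      simp only [pairTrace_tensor, Finset.sum_const, Finset.card_univ, hι, nsmul_eq_mul]
      ring)
    (η := fun i => Pi.single i.1 1) (fun i => IsProbVec.single i.1) ht
  rw [productLaw_single, hξ] at h
  refine h.trans ?_
  have e : pairTrace w (secondMoment c w (∑ i : Σ v, Fin (ξ.1 v),
      tensor (Pi.single i.1 1) (Pi.single i.1 1)) t) = ∑ i : Σ v, Fin (ξ.1 v),
        pairTrace w (secondMoment c w (tensor (Pi.single i.1 1) (Pi.single i.1 1)) t) := by
    simp only [secondMoment, Matrix.sum_vecMul, pairTrace_sum]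
  have hk : (k : ℝ) = ∑ _i : Σ v, Fin (ξ.1 v), (1 : ℝ) := by
    rw [Finset.sum_const, Finset.card_univ, hι]; simp
  have h2 : ∑ i : Σ v, Fin (ξ.1 v), (pairTrace w
      (secondMoment c w (tensor (Pi.single i.1 1) (Pi.single i.1 1)) t) - 1) ≤ k * M := by
    refine (Finset.sum_le_sum fun i _ => hM i.1).trans_eq ?_
    rw [Finset.sum_const, Finset.card_univ, hι, nsmul_eq_mul]
  rw [Finset.sum_sub_distrib, ← hk, ← e] at h2
  linarith

/-- The time `T` brings the trace below `C` from any point mass; from then on the nonconstant modes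
decay at almost twice the gap. -/
theorem worstTV_le (hc : IsConductance c) (hw : IsSiteWeight w)
    (hgap : 0 < spectralGap c w 1) {lam : V → ℝ} {b : V → V → ℝ} (hb : IsEigenbasis c w lam b)
    {ε : ℝ} (hε0 : 0 ≤ ε) (hε3 : ε ≤ 1 / 3)
    (hε : ∀ x y, x ≠ y → ∑ i ∈ lowModes lam (spectralGap c w 1), (b i x - b i y) ^ 2 ≤
      ε * (1 / w x + 1 / w y)) {T C : ℝ} (hT : 0 ≤ T)
    (hC : ∀ x, pairTrace w (secondMoment c w (tensor (Pi.single x 1) (Pi.single x 1)) T) ≤ C)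
    {u : ℝ} (hu : 0 ≤ u) :
    worstTV c w k (T + u) ≤
      √(2 * (k * (4 * C * Real.exp (-((2 - 3 * ε) * spectralGap c w 1) * u)))) := by
  refine worstTV_le_of_pairTrace_le hc hw (by linarith) fun x => ?_
  have hq : ∀ t, 0 ≤ t → ∀ a, 0 ≤
      pairForm (secondMoment c w (tensor (Pi.single x 1) (Pi.single x 1)) t) a a := fun t ht a =>
    pairForm_secondMoment_nonneg hc.nonneg hw.pos (IsProbVec.single x) ht a
  have hq1 : ∀ t, 0 ≤ t →
      pairForm (secondMoment c w (tensor (Pi.single x 1) (Pi.single x 1)) t) 1 1 = 1 := fun t ht =>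
    pairForm_secondMoment_one hc.nonneg hw.pos (IsProbVec.single x) ht
  have h1 := (hb.modeMass_decay hc hw hgap hε0 hε3 hε (IsProbVec.single x) hT hu).2
  have h2 := (hb.pairTrace_bounds hc hw hgap (hq _ (by linarith)) (hq1 (T + u) (by linarith))
    hgap).1
  have h3 := (hb.pairTrace_bounds hc hw hgap (hq _ hT) (hq1 _ hT) hgap).2
  refine (h2.trans h1).trans ?_
  exact mul_le_mul_of_nonneg_right (by linarith [hC x]) (Real.exp_pos _).le

end UpperBound

/-! ### Lower bound on the distance to equilibrium. -/

section LowerBound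

variable {V : Type*} [Fintype V] [DecidableEq V] {c : V → V → ℝ} {w : V → ℝ} {k : ℕ}

/-- Affine inequalities between the law of the configuration and the second moments persist in
time, for initially independent and identically distributed particles. -/
theorem productLaw_semigroup_affine (hc : IsConductance c) (hw : IsSiteWeight w)
    (f : Config V k → ℝ) (F : V × V → ℝ) (r : ℝ)
    (h : ∀ η : V → ℝ, IsProbVec η →
      r ≤ productLaw (Fintype.card_fin k) (fun _ => η) ⬝ᵥ f + tensor η η ⬝ᵥ F)
    {η : V → ℝ} (hη : IsProbVec η) {t : ℝ} (ht : 0 ≤ t) :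
    r ≤ (productLaw (Fintype.card_fin k) (fun _ => η) ᵥ* semigroup c w k t) ⬝ᵥ f +
      secondMoment c w (tensor η η) t ⬝ᵥ F := by
  rw [semigroup, generator_eq_sum]
  have := vecMul_exp_mem (fun e : V × V => c e.1 e.2 / 2)
    (fun e => div_nonneg (hc.nonneg _ _) zero_le_two) (fun e => splitMatrix w k e.1 e.2)
    (fun e => pairKernel w e.1 e.2)
    (G := {z | ∃ η : V → ℝ, IsProbVec η ∧
      z = (productLaw (Fintype.card_fin k) (fun _ => η), tensor η η)})
    (D := {z | r ≤ z.1 ⬝ᵥ f + z.2 ⬝ᵥ F})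
    (z := (productLaw (Fintype.card_fin k) (fun _ => η), tensor η η)) ?_ ?_ ?_ ?_ ⟨η, hη, rfl⟩ ht
  · exact this
  · rintro e he z ⟨η, hη, rfl⟩
    refine ⟨η ᵥ* edgeKernel w e.1 e.2, hη.vecMul_edgeKernel hw.pos _ _, ?_⟩
    have hne : e.1 ≠ e.2 := fun h => he (by rw [h, hc.diag, zero_div])
    simp only [productLaw_vecMul_splitMatrix _ hw.pos hne, pairKernel, tensor_vecMul_kronecker]
  · rintro z ⟨η, hη, rfl⟩
    exact h η hη
  · rintro z hz z' hz' a s ha hs has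
    rw [Set.mem_ofPred_eq] at *
    rw [Prod.fst_add, Prod.snd_add, Prod.smul_fst, Prod.smul_snd, Prod.smul_fst, Prod.smul_snd,
      add_dotProduct, add_dotProduct, smul_dotProduct, smul_dotProduct, smul_dotProduct,
      smul_dotProduct]
    simp only [smul_eq_mul]
    have h1 := mul_le_mul_of_nonneg_left hz ha
    have h2 := mul_le_mul_of_nonneg_left hz' hs
    have h5 : r = (a + s) * r := by rw [has, one_mul]
    linarith
  · exact isClosed_le continuous_const
      ((continuous_fst.dotProduct continuous_const).add (continuous_snd.dotProduct continuous_const))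

/-- The worst deterministic start is at least as far from equilibrium as the average over a random
one, so i.i.d. starts are allowed in the lower bound. -/
theorem sum_vecMul_semigroup_sub_le_worstTV (c : V → V → ℝ) (w : V → ℝ) {p : Config V k → ℝ}
    (hp : ∀ ξ, 0 ≤ p ξ) (hp1 : ∑ ξ, p ξ = 1) (A : Finset (Config V k)) (t : ℝ) :
    ∑ ζ ∈ A, (p ᵥ* semigroup c w k t) ζ - ∑ ζ ∈ A, multinomial w k ζ ≤ worstTV c w k t := by
  have h1 : ∀ ξ : Config V k, ∑ ζ ∈ A, (Pi.single ξ 1 ᵥ* semigroup c w k t) ζ -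
      ∑ ζ ∈ A, multinomial w k ζ ≤ worstTV c w k t := fun ξ =>
    (le_abs_self _).trans ((abs_sub_le_tvDist _ _ A).trans
      (le_ciSup (f := fun ξ : Config V k =>
        tvDist (Pi.single ξ 1 ᵥ* semigroup c w k t) (multinomial w k))
        (Set.finite_range _).bddAbove ξ))
  have h2 : ∑ ζ ∈ A, (p ᵥ* semigroup c w k t) ζ =
      ∑ ξ, p ξ * ∑ ζ ∈ A, (Pi.single ξ 1 ᵥ* semigroup c w k t) ζ := by
    generalize semigroup c w k t = S
    have hrow : ∀ ξ ζ : Config V k, (Pi.single ξ 1 ᵥ* S) ζ = S ξ ζ := fun ξ ζ => by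
      simp [Matrix.vecMul]
    simp only [hrow, Finset.mul_sum]
    rw [Finset.sum_comm]
    exact Finset.sum_congr rfl fun ζ _ => rfl
  have h3 : ∑ ζ ∈ A, multinomial w k ζ = ∑ ξ, p ξ * ∑ ζ ∈ A, multinomial w k ζ := by
    rw [← Finset.sum_mul, hp1, one_mul]
  rw [h2, h3, ← Finset.sum_sub_distrib]
  calc _ ≤ ∑ ξ, p ξ * worstTV c w k t := Finset.sum_le_sum fun ξ _ => by
        rw [← mul_sub]; exact mul_le_mul_of_nonneg_left (h1 ξ) (hp ξ)
    _ = worstTV c w k t := by rw [← Finset.sum_mul, hp1, one_mul]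

theorem le_worstTV (hc : IsConductance c) (hw : IsSiteWeight w)
    (hgap : 0 < spectralGap c w 1) {lam : V → ℝ} {b : V → V → ℝ} (hb : IsEigenbasis c w lam b)
    {ε : ℝ} (hε0 : 0 ≤ ε) (hε3 : ε ≤ 1 / 3)
    (hε : ∀ x y, x ≠ y → ∑ i ∈ lowModes lam (spectralGap c w 1), (b i x - b i y) ^ 2 ≤
      ε * (1 / w x + 1 / w y)) {B : ℝ} (hB0 : 0 < B)
    (hB : ∀ x, ∑ i ∈ lowModes lam (spectralGap c w 1), b i x ^ 2 ≤ B ^ 2) (hk : 0 < k)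
    {t : ℝ} (ht : 0 ≤ t) :
    1 - 8 * B ^ 4 * Real.exp (2 * (spectralGap c w 1 * t)) / k -
      4 * (Real.exp (3 * ε * (spectralGap c w 1 * t)) - 1) ≤ worstTV c w k t := by
  obtain ⟨j, hj⟩ := hb.exists_lam_eq_gap hc hw hgap
  set θ := spectralGap c w 1 with hθ
  have hj0 : lam j ≠ 0 := by rw [hj]; exact hgap.ne'
  have hjlow : j ∈ lowModes lam θ :=
    Finset.mem_filter.2 ⟨Finset.mem_univ j, hj0, by rw [hj]; linarith⟩
  have hjB : ∀ v, b j v ^ 2 ≤ B ^ 2 := fun v =>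
    (Finset.single_le_sum (f := fun i => b i v ^ 2) (fun i _ => sq_nonneg _) hjlow).trans (hB v)
  -- The strongest tilt along the gap eigenfunction that `|b j| ≤ B` guarantees to be nonnegative.
  -- By orthogonality it excites mode `j` alone among the nonconstant modes.
  set η : V → ℝ := fun v => w v * (1 + b j v / B) with hη
  have hηb : ∀ i, η ⬝ᵥ b i = ∑ v, w v * b i v + (if j = i then 1 else 0) / B := by
    intro i
    rw [← hb.orthonormal j i, Finset.sum_div, ← Finset.sum_add_distrib]
    exact Finset.sum_congr rfl fun v _ => by simp only [hη]; ring
  have hηp : IsProbVec η := by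
    constructor
    · intro v
      refine mul_nonneg (hw.pos v).le ?_
      have := (abs_le.1 (abs_le_of_sq_le_sq (hjB v) hB0.le)).1
      have : -1 ≤ b j v / B := by rw [le_div_iff₀ hB0]; linarith
      linarith
    · simp only [hη, mul_add, mul_one, Finset.sum_add_distrib, hw.sum_eq_one]
      have : ∑ v, w v * (b j v / B) = (∑ v, w v * b j v) / B := by
        rw [Finset.sum_div]; exact Finset.sum_congr rfl fun v _ => by ring
      rw [this, hb.sum_eq_zero hj0]; simp
  set p := productLaw (Fintype.card_fin k) (fun _ => η) ᵥ* semigroup c w k t with hp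
  set q := secondMoment c w (tensor η η) t with hq
  have haff := fun f F r h => productLaw_semigroup_affine (k := k) hc hw f F r h hηp ht
  have hp0 : ∀ ζ, 0 ≤ p ζ := by
    intro ζ
    have := haff (Pi.single ζ 1) 0 0 fun η hη => by
      simpa using productLaw_nonneg _ (fun _ => hη) ζ
    simpa using this
  have hp1 : ∑ ζ, p ζ = 1 := by
    have h1 := haff 1 0 1 fun η hη => by
      rw [dotProduct_one, sum_productLaw _ fun _ => hη]; simp
    have h2 := haff (-1) 0 (-1) fun η hη => by
      rw [dotProduct_neg, dotProduct_one, sum_productLaw _ fun _ => hη]; simp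
    rw [dotProduct_zero, add_zero, dotProduct_one] at h1
    rw [dotProduct_zero, add_zero, dotProduct_neg, dotProduct_one] at h2
    linarith
  -- Pairing with the constant `1` reads off first moments; the noise term vanishes because `1` has
  -- no increments, so the decay is exact.
  have hq1 : pairForm q (b j) 1 = Real.exp (-θ * t) * (1 / B) := by
    have h1 := eq_exp_of_deriv_eq (r := θ)
      (f := fun s => pairForm (secondMoment c w (tensor η η) s) (b j) 1) (fun s _ => by
        have := hasDerivAt_pairForm c w (tensor η η) (b j) 1 s
        rw [dotProduct_pairGenerator_mulVec, hb.eigen, pairForm_smul_left,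
          siteGenerator_mulVec c w 1, hj] at this
        convert! this using 1
        simp [pairForm, tensor, dotProduct]) ht
    rw [secondMoment_zero, pairForm_tensor, hηb, hb.sum_eq_zero hj0, dotProduct_one,
      hηp.sum_eq_one, if_pos rfl, zero_add, mul_one] at h1
    exact h1
  set m := k * (Real.exp (-θ * t) / B) with hm
  have hk' : (0 : ℝ) < k := Nat.cast_pos.2 hk
  have hm0 : 0 < m := by positivity
  have hΦ1 : ∑ ζ, p ζ * linearStat (b j) ζ = m := by
    have hgen : ∀ η : V → ℝ, IsProbVec η → productLaw (Fintype.card_fin k) (fun _ => η) ⬝ᵥ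
        linearStat (b j) = k * (tensor η η ⬝ᵥ tensor (b j) 1) := fun η hη => by
      rw [tensor_dotProduct_tensor, dotProduct_one, hη.sum_eq_one, mul_one]
      exact sum_productLaw_linearStat _ hη (b j)
    have h1 := haff (linearStat (b j)) (-((k : ℝ) • tensor (b j) 1)) 0 fun η hη => by
      rw [hgen η hη, dotProduct_neg, dotProduct_smul, smul_eq_mul]; linarith
    have h2 := haff (-linearStat (b j)) ((k : ℝ) • tensor (b j) 1) 0 fun η hη => by
      rw [dotProduct_neg, hgen η hη, dotProduct_smul, smul_eq_mul]; linarith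
    rw [dotProduct_neg, dotProduct_smul, smul_eq_mul] at h1
    rw [dotProduct_neg, dotProduct_smul, smul_eq_mul] at h2
    have h3 : p ⬝ᵥ linearStat (b j) = k * pairForm q (b j) 1 := by
      simp only [pairForm]; linarith
    rw [hq1] at h3
    rw [hm, div_eq_mul_one_div]
    exact h3
  -- Initially the fast mass is zero and the slow mass is that of mode `j`, so the mode estimate
  -- holds without a prefactor and matches the squared mean up to `exp (3 ε θ t)`.
  have hmode : pairForm q (b j) (b j) ≤ Real.exp (-((2 - 3 * ε) * θ) * t) * (1 / B ^ 2) := by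
    have h1 := (hb.modeMass_decay hc hw hgap hε0 hε3 hε hηp le_rfl ht).1
    rw [zero_add, secondMoment_zero] at h1
    have h2 : pairForm q (b j) (b j) ≤ modeMass b (lowModes lam θ) q :=
      Finset.single_le_sum (f := fun i => pairForm q (b i) (b i))
        (fun i _ => pairForm_secondMoment_nonneg hc.nonneg hw.pos hηp ht (b i)) hjlow
    have h3 : modeMass b (lowModes lam θ) (tensor η η) = 1 / B ^ 2 := by
      rw [modeMass, Finset.sum_eq_single_of_mem j hjlow]
      · rw [pairForm_tensor, hηb, hb.sum_eq_zero hj0, if_pos rfl]; field_simp; ring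
      · intro i hi hij
        rw [pairForm_tensor, hηb, hb.sum_eq_zero (Finset.mem_filter.1 hi).2.1, if_neg hij.symm]
        simp
    have h4 : modeMass b (highModes lam θ) (tensor η η) = 0 := by
      refine Finset.sum_eq_zero fun i hi => ?_
      have hi' := (Finset.mem_filter.1 hi).2
      have hi0 : lam i ≠ 0 := by intro h; linarith
      have hij : j ≠ i := by rintro rfl; linarith
      rw [pairForm_tensor, hηb, hb.sum_eq_zero hi0, if_neg hij]
      simp
    rw [h3, h4, mul_zero, add_zero] at h1
    exact h2.trans h1
  have hΦ2 : ∑ ζ, p ζ * linearStat (b j) ζ ^ 2 ≤ k * B ^ 2 + k ^ 2 * pairForm q (b j) (b j) := by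
    have h1 := haff (-fun ζ => linearStat (b j) ζ ^ 2) ((k : ℝ) ^ 2 • tensor (b j) (b j))
      (-(k * B ^ 2)) fun η hη => by
        have := sum_productLaw_linearStat_sq_le (Fintype.card_fin k) hη hjB
        rw [dotProduct_neg, dotProduct_smul, smul_eq_mul, tensor_dotProduct_tensor, ← sq]
        simp only [dotProduct] at this ⊢
        linarith
    rw [dotProduct_neg, dotProduct_smul, smul_eq_mul] at h1
    simp only [pairForm, dotProduct] at h1 ⊢
    linarith
  have hμ : ∑ ζ, multinomial w k ζ * linearStat (b j) ζ ^ 2 ≤ k * B ^ 2 := by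
    have := sum_productLaw_linearStat_sq_le (Fintype.card_fin k) hw.isProbVec hjB
    have h0 : w ⬝ᵥ b j = 0 := hb.sum_eq_zero hj0
    rw [h0] at this
    rw [multinomial_eq_productLaw (Fintype.card_fin k)]
    linarith
  have hμ0 : ∀ ζ, 0 ≤ multinomial w k ζ := fun ζ => by
    rw [multinomial_eq_productLaw (Fintype.card_fin k)]
    exact productLaw_nonneg _ (fun _ => hw.isProbVec) ζ
  obtain ⟨A, hA⟩ := exists_finset_one_sub_le hp0 hp1 hμ0 (linearStat (b j)) hm0 hΦ1
  have hTV := sum_vecMul_semigroup_sub_le_worstTV c w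
    (fun ξ => productLaw_nonneg (Fintype.card_fin k) (fun _ => hηp) ξ)
    (sum_productLaw (Fintype.card_fin k) fun _ => hηp) A t
  have hm2 : 0 < m ^ 2 := by positivity
  have hexp : Real.exp (-((2 - 3 * ε) * θ) * t) =
      Real.exp (-θ * t) ^ 2 * Real.exp (3 * ε * (θ * t)) := by
    rw [sq, ← Real.exp_add, ← Real.exp_add]; congr 1; ring
  have hsec : (k : ℝ) ^ 2 * pairForm q (b j) (b j) ≤ m ^ 2 * Real.exp (3 * ε * (θ * t)) := by
    have := mul_le_mul_of_nonneg_left hmode (sq_nonneg (k : ℝ))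
    refine this.trans_eq ?_
    rw [hexp, hm]; ring
  have hkm : k * B ^ 2 / m ^ 2 = B ^ 4 * Real.exp (2 * (θ * t)) / k := by
    have h1 : Real.exp (2 * (θ * t)) * Real.exp (-θ * t) ^ 2 = 1 := by
      rw [sq, ← Real.exp_add, ← Real.exp_add]; ring_nf; exact Real.exp_zero
    have hE := Real.exp_pos (-θ * t)
    rw [div_eq_div_iff hm2.ne' hk'.ne', hm, mul_pow, div_pow]
    generalize Real.exp (-θ * t) = E at h1 hE
    generalize Real.exp (2 * (θ * t)) = E' at h1
    field_simp
    linear_combination (-1 : ℝ) * h1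
  have h1 : 4 * (∑ ζ, p ζ * linearStat (b j) ζ ^ 2 - m ^ 2) / m ^ 2 ≤
      4 * (B ^ 4 * Real.exp (2 * (θ * t)) / k) + 4 * (Real.exp (3 * ε * (θ * t)) - 1) := by
    rw [← hkm, div_le_iff₀ hm2]
    have : (4 * (k * B ^ 2 / m ^ 2) + 4 * (Real.exp (3 * ε * (θ * t)) - 1)) * m ^ 2 =
        4 * (k * B ^ 2) + 4 * (m ^ 2 * Real.exp (3 * ε * (θ * t)) - m ^ 2) := by
      field_simp
    rw [this]
    linarith
  have h2 : 4 * (∑ ζ, multinomial w k ζ * linearStat (b j) ζ ^ 2) / m ^ 2 ≤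
      4 * (B ^ 4 * Real.exp (2 * (θ * t)) / k) := by
    rw [← hkm, mul_div_assoc]
    exact mul_le_mul_of_nonneg_left (div_le_div_of_nonneg_right hμ hm2.le) (by norm_num)
  have h3 : 8 * B ^ 4 * Real.exp (2 * (θ * t)) / k =
      8 * (B ^ 4 * Real.exp (2 * (θ * t)) / k) := by ring
  rw [h3]
  linarith

end LowerBound

/-! ### Explicit constants and evaluation within the cutoff window. -/

section Cutoff

/-- The second moments at the Nash time and the spread of the slow modes, with explicit
constants. -/
theorem exists_isEigenbasis_bounds {V : Type*} [Fintype V] [DecidableEq V] {c : V → V → ℝ}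
    {w : V → ℝ} (hc : IsConductance c) (hw : IsSiteWeight w) {d tN T D K L cell : ℝ} (hd : 0 < d)
    (hdD : d ≤ D) (hN : 0 < tN) (hT : 0 < T) (hK : tN ≤ K * T) (h : NashInequality c w d tN T)
    (hL : spectralGap c w 1 * T ≤ L) (hcell : 0 < cell) (hell : ∀ x y, w x / w y ≤ cell)
    (hV : 0 < Fintype.card V) :
    let F := (K * Real.exp (2 / D) / (Real.exp (2 / D) - 1)) ^ (1 / (2 / D))
    ∃ lam b, IsEigenbasis c w lam b ∧
      (∀ x, pairTrace w (secondMoment c w (tensor (Pi.single x 1) (Pi.single x 1)) T) ≤ F) ∧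
      (∀ x, ∑ i ∈ lowModes lam (spectralGap c w 1), b i x ^ 2 ≤ √(Real.exp (8 * L) * F) ^ 2) ∧
      ∀ x y, x ≠ y → ∑ i ∈ lowModes lam (spectralGap c w 1), (b i x - b i y) ^ 2 ≤
        2 * √(Real.exp (8 * L) * F) ^ 2 * cell / Fintype.card V * (1 / w x + 1 / w y) := by
  intro F
  obtain ⟨lam, b, hb⟩ := exists_isEigenbasis c hw.pos
  have hF : ∀ x, pairTrace w
      (secondMoment c w (tensor (Pi.single x 1) (Pi.single x 1)) T) ≤ F := fun x =>
    pairTrace_secondMoment_le hc hw hd hdD hN hT hK h (IsProbVec.single x)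
  have hF1 : ∀ _ : V, 1 ≤ F := fun x =>
    (pairTrace_secondMoment_nash hc hw hd hdD hN h (IsProbVec.single x) hT.le).1.trans (hF x)
  have hlow : ∀ x, ∑ i ∈ lowModes lam (spectralGap c w 1), b i x ^ 2 ≤
      √(Real.exp (8 * L) * F) ^ 2 := by
    intro x
    have hF0 : 0 ≤ F := zero_le_one.trans (hF1 x)
    rw [Real.sq_sqrt (mul_nonneg (Real.exp_pos _).le hF0)]
    refine (hb.sum_lowModes_sq_le hc hw x hT.le).trans ?_
    refine (mul_le_mul_of_nonneg_left (hF x) (Real.exp_pos _).le).trans ?_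
    exact mul_le_mul_of_nonneg_right (Real.exp_le_exp.2 (by linarith)) hF0
  have hN0 : (0 : ℝ) < Fintype.card V := Nat.cast_pos.2 hV
  refine ⟨lam, b, hb, hF, hlow, fun x y _ =>
    IsEigenbasis.sum_lowModes_sub_sq_le hw.pos hN0 hcell (fun v => ?_) hlow x y⟩
  -- Summing the ellipticity bound over all sites gives `w v ≤ cell / N`.
  have h1 : ∑ _u : V, w v ≤ ∑ u, cell * w u :=
    Finset.sum_le_sum fun u _ => (div_le_iff₀ (hw.pos u)).1 (hell v u)
  rw [← Finset.mul_sum, hw.sum_eq_one, mul_one, Finset.sum_const, Finset.card_univ,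
    nsmul_eq_mul] at h1
  rw [le_div_iff₀ hN0]
  linarith

theorem tendsto_log_div_of_isBigO_sq {k : ℕ → ℕ} (hk : Tendsto k atTop atTop)
    (hkn : (fun n => (k n : ℝ)) =O[atTop] fun n => (n : ℝ) ^ 2) :
    Tendsto (fun n => Real.log (k n) / n) atTop (𝓝 0) := by
  obtain ⟨K, hK, hb⟩ := hkn.exists_pos
  have h1 : Tendsto (fun n : ℕ => Real.log K / (n : ℝ) + 2 * (Real.log n / n)) atTop (𝓝 0) := by
    have e1 := tendsto_const_div_atTop_nhds_zero_nat (Real.log K)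
    have e2 := (Real.isLittleO_log_id_atTop.tendsto_div_nhds_zero.comp
      tendsto_natCast_atTop_atTop).const_mul (2 : ℝ)
    simpa using e1.add e2
  refine squeeze_zero' (Eventually.of_forall fun n => ?_) ?_ h1
  · exact div_nonneg (Real.log_natCast_nonneg _) (Nat.cast_nonneg _)
  · filter_upwards [hb.bound, hk.eventually_gt_atTop 0, eventually_gt_atTop 0] with n hn hkn0 hn0
    have hn0' : (0 : ℝ) < n := Nat.cast_pos.2 hn0
    have hk0' : (0 : ℝ) < k n := Nat.cast_pos.2 hkn0
    rw [Real.norm_of_nonneg hk0'.le, Real.norm_of_nonneg (by positivity)] at hn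
    have := Real.log_le_log hk0' hn
    rw [Real.log_mul hK.ne' (by positivity), Real.log_pow] at this
    calc Real.log (k n) / n ≤ (Real.log K + (2 : ℕ) * Real.log n) / n :=
          div_le_div_of_nonneg_right this hn0'.le
      _ = _ := by push_cast; ring

/-- The upper bound on the distance to equilibrium at a time within the cutoff window. -/
theorem worstTV_cutoff_le {V : Type*} [Fintype V] [DecidableEq V] {c : V → V → ℝ}
    {w lam : V → ℝ} {b : V → V → ℝ} {k : ℕ} (hc : IsConductance c) (hw : IsSiteWeight w)
    (hgap : 0 < spectralGap c w 1) (hb : IsEigenbasis c w lam b) {ε T F L C : ℝ} (hε0 : 0 ≤ ε)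
    (hε3 : ε ≤ 1 / 3)
    (hε : ∀ x y, x ≠ y → ∑ i ∈ lowModes lam (spectralGap c w 1), (b i x - b i y) ^ 2 ≤
      ε * (1 / w x + 1 / w y)) (hT : 0 ≤ T) (hF0 : 0 ≤ F)
    (hF : ∀ x, pairTrace w (secondMoment c w (tensor (Pi.single x 1) (Pi.single x 1)) T) ≤ F)
    (hL : spectralGap c w 1 * T ≤ L) (hCL : L ≤ C) (hk : 0 < k)
    (hεk : 3 / 2 * ε * Real.log k ≤ 1) :
    worstTV c w k (mixingTime c w k + C * relaxationTime c w) ≤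
      √(8 * F * Real.exp (1 + L - C)) := by
  set θ := spectralGap c w 1 with hθ
  have ht : mixingTime c w k + C * relaxationTime c w =
      T + (θ⁻¹ * (Real.log k / 2 + C) - T) := by
    rw [mixingTime, relaxationTime, ← hθ]; ring
  have hlog : 0 ≤ Real.log k := Real.log_natCast_nonneg k
  have hu : θ * (θ⁻¹ * (Real.log k / 2 + C) - T) = Real.log k / 2 + C - θ * T := by
    rw [mul_sub, ← mul_assoc, mul_inv_cancel₀ hgap.ne', one_mul]
  have hu0 : 0 ≤ θ⁻¹ * (Real.log k / 2 + C) - T := by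
    refine nonneg_of_mul_nonneg_right ?_ hgap
    rw [hu]; linarith
  rw [ht]
  refine (worstTV_le hc hw hgap hb hε0 hε3 hε hT hF hu0).trans (Real.sqrt_le_sqrt ?_)
  have hk' : (0 : ℝ) < k := Nat.cast_pos.2 hk
  have hexp : k * Real.exp (-((2 - 3 * ε) * θ) * (θ⁻¹ * (Real.log k / 2 + C) - T)) ≤
      Real.exp (1 + L - C) := by
    nth_rewrite 1 [← Real.exp_log hk']
    rw [← Real.exp_add]
    refine Real.exp_le_exp.2 ?_
    have e : -((2 - 3 * ε) * θ) * (θ⁻¹ * (Real.log k / 2 + C) - T) =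
        -((2 - 3 * ε) * (Real.log k / 2 + C - θ * T)) := by
      rw [← hu]; ring
    rw [e]
    -- The part `(2 - 3 * ε) * log k / 2` of the exponent absorbs `log k` up to `3 / 2 * ε * log k ≤
    -- 1`; for the rest, `2 - 3 * ε ≥ 1` suffices.
    have h1 : 1 * (C - L) ≤ (2 - 3 * ε) * (C - θ * T) :=
      mul_le_mul (by linarith) (by linarith) (by linarith) (by linarith)
    nlinarith
  have := mul_le_mul_of_nonneg_left hexp (by linarith : 0 ≤ 8 * F)
  linarith

/-- The lower bound on the distance to equilibrium at a time within the cutoff window. -/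
theorem le_worstTV_cutoff {V : Type*} [Fintype V] [DecidableEq V] {c : V → V → ℝ}
    {w lam : V → ℝ} {b : V → V → ℝ} {k : ℕ} (hc : IsConductance c) (hw : IsSiteWeight w)
    (hgap : 0 < spectralGap c w 1) (hb : IsEigenbasis c w lam b) {ε B C : ℝ} (hε0 : 0 ≤ ε)
    (hε3 : ε ≤ 1 / 3)
    (hε : ∀ x y, x ≠ y → ∑ i ∈ lowModes lam (spectralGap c w 1), (b i x - b i y) ^ 2 ≤
      ε * (1 / w x + 1 / w y)) (hB0 : 0 < B)
    (hB : ∀ x, ∑ i ∈ lowModes lam (spectralGap c w 1), b i x ^ 2 ≤ B ^ 2) (hC : 0 ≤ C)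
    (hk : 0 < k) (hCk : C ≤ Real.log k / 2) :
    1 - 8 * B ^ 4 * Real.exp (-(2 * C)) - 4 * (Real.exp (3 / 2 * ε * Real.log k) - 1) ≤
      worstTV c w k (mixingTime c w k - C * relaxationTime c w) := by
  set θ := spectralGap c w 1 with hθ
  have ht : mixingTime c w k - C * relaxationTime c w = θ⁻¹ * (Real.log k / 2 - C) := by
    rw [mixingTime, relaxationTime, ← hθ]; ring
  have hk' : (0 : ℝ) < k := Nat.cast_pos.2 hk
  have hθt : θ * (θ⁻¹ * (Real.log k / 2 - C)) = Real.log k / 2 - C := by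
    rw [← mul_assoc, mul_inv_cancel₀ hgap.ne', one_mul]
  rw [ht]
  refine le_trans ?_ (le_worstTV hc hw hgap hb hε0 hε3 hε hB0 hB hk
    (mul_nonneg (inv_nonneg.2 hgap.le) (by linarith)))
  rw [hθt]
  have h1 : 8 * B ^ 4 * Real.exp (2 * (Real.log k / 2 - C)) / k =
      8 * B ^ 4 * Real.exp (-(2 * C)) := by
    rw [show 2 * (Real.log k / 2 - C) = Real.log k + -(2 * C) by ring, Real.exp_add,
      Real.exp_log hk']
    field_simp
  have h2 : Real.exp (3 * ε * (Real.log k / 2 - C)) ≤ Real.exp (3 / 2 * ε * Real.log k) := by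
    refine Real.exp_le_exp.2 ?_
    nlinarith [mul_nonneg hε0 hC]
  rw [h1]
  linarith

end Cutoff

end BinomialSplitting

/-! ### The cutoff theorem: uniform constants and limits. -/

theorem mainTheorem2
    (V : ℕ → Type*) [∀ n, Fintype (V n)] [∀ n, DecidableEq (V n)]
    (hV : ∀ n, Fintype.card (V n) = n)
    (c : ∀ n, V n → V n → ℝ) (hc : ∀ n, 1 ≤ n → BinomialSplitting.IsConductance (c n))
    (w : ∀ n, V n → ℝ) (hw : ∀ n, 1 ≤ n → BinomialSplitting.IsSiteWeight (w n))
    -- finite-dimensional geometries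
    (d tNash T : ℕ → ℝ)
    (hpos : ∀ n, 1 ≤ n → 0 < d n ∧ 0 < tNash n ∧ 0 < T n)
    (hNash : ∀ n, 1 ≤ n → BinomialSplitting.NashInequality (c n) (w n) (d n) (tNash n) (T n))
    (hd : d =O[atTop] fun _ => (1 : ℝ))
    (htNash : tNash =O[atTop] fun n => BinomialSplitting.relaxationTime (c n) (w n))
    (hT : T =Θ[atTop] tNash)
    -- uniformly elliptic site-weights
    (c_ell : ℝ) (hell : ∀ n, 1 ≤ n → ∀ x y : V n, w n x / w n y ≤ c_ell)
    -- number of particles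
    (k : ℕ → ℕ) (hk : Tendsto k atTop atTop)
    (hkn : (fun n => (k n : ℝ)) =O[atTop] fun n => (n : ℝ) ^ 2)
    (δ : ℝ) (hδ : δ ∈ Set.Ioo (0 : ℝ) 1) :
    ∃ C : ℝ, 0 < C ∧
      limsup (fun n => BinomialSplitting.worstTV (c n) (w n) (k n)
        (BinomialSplitting.mixingTime (c n) (w n) (k n)
          + C * BinomialSplitting.relaxationTime (c n) (w n))) atTop ≤ δ ∧
      1 - δ ≤ liminf (fun n => BinomialSplitting.worstTV (c n) (w n) (k n)
        (BinomialSplitting.mixingTime (c n) (w n) (k n)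
          - C * BinomialSplitting.relaxationTime (c n) (w n))) atTop := by
  open BinomialSplitting in
  obtain ⟨hδ0, -⟩ := hδ
  obtain ⟨D, hD0, hD⟩ := hd.exists_pos
  obtain ⟨K₁, hK₁, hN⟩ := htNash.exists_pos
  obtain ⟨K₂, hK₂, hT2⟩ := hT.1.exists_pos
  obtain ⟨K₃, hK₃, hT3⟩ := hT.2.exists_pos
  -- The one-site graph already forces `1 ≤ c_ell`.
  have hcell : 0 < c_ell := by
    obtain ⟨x⟩ : Nonempty (V 1) := Fintype.card_pos_iff.1 (by rw [hV]; exact one_pos)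
    have := hell 1 le_rfl x x
    rw [div_self ((hw 1 le_rfl).pos x).ne'] at this
    linarith
  set L := K₂ * K₁ with hL
  set F := (K₃ * Real.exp (2 / D) / (Real.exp (2 / D) - 1)) ^ (1 / (2 / D)) with hFdef
  have hF0 : 0 < F := by
    refine Real.rpow_pos_of_pos (div_pos (by positivity) ?_) _
    have := Real.add_one_lt_exp (x := 2 / D) (by positivity)
    have : 0 < 2 / D := by positivity
    linarith
  set B := √(Real.exp (8 * L) * F) with hB
  have hB0 : 0 < B := Real.sqrt_pos.2 (by positivity)
  have hL0 : 0 < L := by positivity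
  -- `L` pays for the Nash time in units of the relaxation time, `1` for the error `3 / 2 * ε * log
  -- k`; the logarithms bring the upper bound to `δ` and the Chebyshev term of the lower bound to `δ
  -- / 2`.
  set C := L + 1 + |Real.log (8 * F / δ ^ 2)| + |Real.log (16 * B ^ 4 / δ)| with hC
  have hC0 : 0 < C := by positivity
  have hCL : L ≤ C := by
    have := abs_nonneg (Real.log (8 * F / δ ^ 2))
    have := abs_nonneg (Real.log (16 * B ^ 4 / δ))
    linarith
  have hCu : √(8 * F * Real.exp (1 + L - C)) ≤ δ := by
    rw [Real.sqrt_le_left hδ0.le]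
    have h1 : 1 + L - C ≤ -Real.log (8 * F / δ ^ 2) := by
      have := le_abs_self (Real.log (8 * F / δ ^ 2))
      have := abs_nonneg (Real.log (16 * B ^ 4 / δ))
      linarith
    have h2 := Real.exp_le_exp.2 h1
    rw [Real.exp_neg, Real.exp_log (by positivity)] at h2
    calc 8 * F * Real.exp (1 + L - C) ≤ 8 * F * (8 * F / δ ^ 2)⁻¹ :=
          mul_le_mul_of_nonneg_left h2 (by positivity)
      _ = δ ^ 2 := by field_simp
  have hCl : 8 * B ^ 4 * Real.exp (-(2 * C)) ≤ δ / 2 := by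
    have h1 : -(2 * C) ≤ -Real.log (16 * B ^ 4 / δ) := by
      have := abs_nonneg (Real.log (8 * F / δ ^ 2))
      have := le_abs_self (Real.log (16 * B ^ 4 / δ))
      linarith
    have h2 := Real.exp_le_exp.2 h1
    rw [Real.exp_neg (Real.log _), Real.exp_log (by positivity)] at h2
    calc 8 * B ^ 4 * Real.exp (-(2 * C)) ≤ 8 * B ^ 4 * (16 * B ^ 4 / δ)⁻¹ :=
          mul_le_mul_of_nonneg_left h2 (by positivity)
      _ = δ / 2 := by field_simp; norm_num
  set ε : ℕ → ℝ := fun n => 2 * B ^ 2 * c_ell / n with hε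
  have hε0 : ∀ n, 0 ≤ ε n := fun n => by positivity
  have hεlim : Tendsto ε atTop (𝓝 0) := tendsto_const_div_atTop_nhds_zero_nat _
  have hεk : Tendsto (fun n => 3 / 2 * ε n * Real.log (k n)) atTop (𝓝 0) := by
    have := (BinomialSplitting.tendsto_log_div_of_isBigO_sq hk hkn).const_mul
      (3 / 2 * (2 * B ^ 2 * c_ell))
    rw [mul_zero] at this
    refine this.congr fun n => ?_
    simp only [hε]; ring
  have hexplim : Tendsto (fun n => 4 * (Real.exp (3 / 2 * ε n * Real.log (k n)) - 1)) atTop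
      (𝓝 0) := by
    have := ((Real.continuous_exp.tendsto 0).comp hεk).sub_const 1 |>.const_mul 4
    simpa using this
  have hlogk : Tendsto (fun n => Real.log (k n) / 2) atTop atTop :=
    (Real.tendsto_log_atTop.comp (tendsto_natCast_atTop_atTop.comp hk)).atTop_div_const two_pos
  have hgood : ∀ᶠ n in atTop, IsConductance (c n) ∧ IsSiteWeight (w n) ∧
      0 < spectralGap (c n) (w n) 1 ∧ 0 < T n ∧ spectralGap (c n) (w n) 1 * T n ≤ L ∧
      ∃ lam b, IsEigenbasis (c n) (w n) lam b ∧
        (∀ x, pairTrace (w n) (secondMoment (c n) (w n)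
          (tensor (Pi.single x 1) (Pi.single x 1)) (T n)) ≤ F) ∧
        (∀ x, ∑ i ∈ lowModes lam (spectralGap (c n) (w n) 1), b i x ^ 2 ≤ B ^ 2) ∧
        ∀ x y, x ≠ y → ∑ i ∈ lowModes lam (spectralGap (c n) (w n) 1), (b i x - b i y) ^ 2 ≤
          ε n * (1 / w n x + 1 / w n y) := by
    filter_upwards [hD.bound, hN.bound, hT2.bound, hT3.bound, eventually_ge_atTop 1]
      with n hDn hNn hT2n hT3n hn
    obtain ⟨hd0, hN0, hT0⟩ := hpos n hn
    have hcn := hc n hn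
    have hwn := hw n hn
    have hg0 := spectralGap_nonneg hcn hwn
    rw [Real.norm_of_nonneg hd0.le, norm_one, mul_one] at hDn
    rw [Real.norm_of_nonneg hN0.le, relaxationTime, Real.norm_of_nonneg (inv_nonneg.2 hg0)] at hNn
    rw [Real.norm_of_nonneg hT0.le, Real.norm_of_nonneg hN0.le] at hT2n
    rw [Real.norm_of_nonneg hT0.le, Real.norm_of_nonneg hN0.le] at hT3n
    -- A vanishing gap would give `relaxationTime = 0` by the convention for the inverse, and then
    -- the bound on the positive Nash time fails.
    have hg : 0 < spectralGap (c n) (w n) 1 := by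
      refine lt_of_le_of_ne hg0 fun h => ?_
      rw [← h, inv_zero, mul_zero] at hNn
      linarith
    have hLn : spectralGap (c n) (w n) 1 * T n ≤ L := by
      have h1 := hT2n.trans (mul_le_mul_of_nonneg_left hNn hK₂.le)
      have h2 := mul_le_mul_of_nonneg_left h1 hg.le
      refine h2.trans_eq ?_
      rw [hL]; field_simp
    have hVn : 0 < Fintype.card (V n) := by rw [hV]; exact hn
    obtain ⟨lam, b, hb, h1, h2, h3⟩ := exists_isEigenbasis_bounds hcn hwn hd0 hDn hN0 hT0 hT3n
      (hNash n hn) hLn hcell (hell n hn) hVn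
    rw [hV] at h3
    exact ⟨hcn, hwn, hg, hT0, hLn, lam, b, hb, h1, h2, h3⟩
  have hε3 : ∀ᶠ n in atTop, ε n ≤ 1 / 3 :=
    (hεlim.eventually (gt_mem_nhds (by norm_num : (0 : ℝ) < 1 / 3))).mono fun _ h => h.le
  have hkpos := hk.eventually_gt_atTop 0
  refine ⟨C, hC0, ?_, ?_⟩
  · refine limsup_le_of_le (isCoboundedUnder_le_of_le atTop (x := 0) fun n =>
      worstTV_nonneg _ _ _ _) ?_
    filter_upwards [hgood, hε3, hkpos, hεk.eventually (gt_mem_nhds one_pos)]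
      with n ⟨hcn, hwn, hg, hT0, hLn, lam, b, hb, h1, _, h3⟩ hεn hkn0 hεkn
    exact (worstTV_cutoff_le hcn hwn hg hb (hε0 n) hεn h3 hT0.le hF0.le h1 hLn hCL hkn0
      hεkn.le).trans hCu
  · refine le_liminf_of_le ?_ ?_
    · refine IsBoundedUnder.isCoboundedUnder_ge ⟨1, ?_⟩
      rw [eventually_map]
      -- The bound by 1 needs a nonnegative time, which holds once `log k / 2 ≥ C`.
      filter_upwards [hgood, hlogk.eventually_ge_atTop C] with n ⟨hcn, hwn, hg, _⟩ hlog
      refine worstTV_le_one hcn hwn ?_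
      have : mixingTime (c n) (w n) (k n) - C * relaxationTime (c n) (w n) =
          relaxationTime (c n) (w n) * (Real.log (k n) / 2 - C) := by
        rw [mixingTime]; ring
      rw [this]
      exact mul_nonneg (inv_nonneg.2 hg.le) (by linarith)
    · filter_upwards [hgood, hε3, hkpos, hexplim.eventually (gt_mem_nhds (half_pos hδ0)),
        hlogk.eventually_ge_atTop C]
        with n ⟨hcn, hwn, hg, hT0, hLn, lam, b, hb, _, h2, h3⟩ hεn hkn0 hexpn hlog
      have := le_worstTV_cutoff hcn hwn hg hb (hε0 n) hεn h3 hB0 h2 hC0.le hkn0 hlog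
      linarith
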